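/- Fix real constants $\alpha^+>\beta^+>0$ and $\beta^->\alpha^->0$, and put $$\xi=\frac{\log(\beta^- /\alpha^-)}{\log(\alpha^+/\beta^+)}.$$ For an even integer $n\ge 2$, let $x^*\in\{1,-1\}^n$ have equally many entries $1$ and $-1$ (two communities of equal size), and let $A=(A_{ij})$ be a random symmetric $n\times n$ matrix with zero diagonal whose entries $A_{ij}$, $i<j$, are independent, such that $$A_{ij}=\begin{cases}1&\text{with probability }p^+,\\-1&\text{with probability }p^-,\\0&\text{with probability }1-p^+-p^-\end{cases}\quad\text{if }x^*_i=x^*_j,\qquad A_{ij}=\begin{cases}1&\text{with probability }q^+,\\-1&\text{with probability }q^-,\\0&\text{with probability }1-q^+-q^-\end{cases}\quad\text{if }x^*_i\ne x^*_j,$$ where $p^\pm=\alpha^\pm\frac{\log n}{n}$ and $q^\pm=\beta^\pm\frac{\log n}{n}$ all lie in $(0,1]$. Let $\mathcal G^+$ (resp. $\mathcal G^-$) be the graph on $\{1,\dots,n\}$ whose edges are the pairs $\{i,j\}$ with $A_{ij}=1$ (resp. $A_{ij}=-1$), and let $N^\pm$ and $T^\pm$ be the numbers of edges and of triangles of $\mathcal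 G^\pm$. With $\sqrt[3]{\cdot}$ the real cube root, put $$\hat\alpha^\pm=\frac1{\log n}\left(\frac{2N^\pm}{n}+\sqrt[3]{6T^\pm-\frac{8(N^\pm)^3}{n^3}}\right),\qquad \hat\beta^\pm=\frac1{\log n}\left(\frac{2N^\pm}{n}-\sqrt[3]{6T^\pm-\frac{8(N^\pm)^3}{n^3}}\right),\qquad \hat\xi=\frac{\log(\hat\beta^- /\hat\alpha^-)}{\log(\hat\alpha^+/\hat\beta^+)}.$$ Then there are constants $\kappa>0$, $c>0$ and $n_0$, depending only on $\alpha^+,\beta^+,\alpha^-,\beta^-$, such that for all even $n\ge n_0$ and all such $x^*$ and $A$, with probability at least $1-n^{-c}$ the estimator $\hat\xi$ is well defined (both logarithms have positive arguments and the denominator is nonzero) and $$|\hat\xi-\xi|\le\kappa\,(\log n)^{-1/12}.$$ -/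

import Mathlib

open MeasureTheory ProbabilityTheory

noncomputable section

namespace SignedSBM

/-- `x ∈ {1, -1}ⁿ` labels two disjoint communities of equal size:
`{i | x i = 1}` and `{i | x i = -1}`. -/
def IsBalancedLabel {n : ℕ} (x : Fin n → ℤ) : Prop :=
  (∀ i, x i = 1 ∨ x i = -1) ∧
    (Finset.univ.filter fun i => x i = 1).card = (Finset.univ.filter fun i => x i = -1).card

/-- The integer random variable `Y` equals `1`, `-1`, `0` with probability `r`, `s`, `1 - r - s`. -/
def HasSignLaw {Ω : Type*} [MeasurableSpace Ω] (μ : Measure Ω) (Y : Ω → ℤ) (r s : ℝ) : Prop :=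
  μ.real {ω | Y ω = 1} = r ∧ μ.real {ω | Y ω = -1} = s ∧ μ.real {ω | Y ω = 0} = 1 - r - s

/-- The random matrix `A` is the adjacency matrix of a signed graph on `n` nodes generated
according to the signed stochastic block model `SSBM(n, x, p⁺, p⁻, q⁺, q⁻)`. -/
structure IsSSBM {Ω : Type*} [MeasurableSpace Ω] (μ : Measure Ω) {n : ℕ}
    (A : Ω → Matrix (Fin n) (Fin n) ℤ) (x : Fin n → ℤ) (pPos pNeg qPos qNeg : ℝ) : Prop where
  two_le : 2 ≤ n
  balanced : IsBalancedLabel x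
  pPos_mem : pPos ∈ Set.Ioc (0 : ℝ) 1
  pNeg_mem : pNeg ∈ Set.Ioc (0 : ℝ) 1
  qPos_mem : qPos ∈ Set.Ioc (0 : ℝ) 1
  qNeg_mem : qNeg ∈ Set.Ioc (0 : ℝ) 1
  /-- the entries are random variables -/
  measurable_entry : ∀ i j, Measurable fun ω => A ω i j
  symm : ∀ ω i j, A ω i j = A ω j i
  /-- there are no self-loops -/
  diag : ∀ ω i, A ω i i = 0
  /-- the entries above the diagonal are independent -/
  indep : iIndepFun (fun (e : {e : Fin n × Fin n // e.1 < e.2}) ω => A ω e.1.1 e.1.2) μ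
  /-- the law of an entry inside a community -/
  law_same : ∀ i j, i ≠ j → x i = x j → HasSignLaw μ (fun ω => A ω i j) pPos pNeg
  /-- the law of an entry between the two communities -/
  law_diff : ∀ i j, x i ≠ x j → HasSignLaw μ (fun ω => A ω i j) qPos qNeg

/-- The subgraph `G⁺` formed by the positive edges of the signed graph with
(symmetric) adjacency matrix `A`. -/
def posGraph {n : ℕ} (A : Matrix (Fin n) (Fin n) ℤ) : SimpleGraph (Fin n) :=
  SimpleGraph.fromRel fun i j => 0 < A i j

/-- The subgraph `G⁻` formed by the negative edges of the signed graph with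
(symmetric) adjacency matrix `A`. -/
def negGraph {n : ℕ} (A : Matrix (Fin n) (Fin n) ℤ) : SimpleGraph (Fin n) :=
  SimpleGraph.fromRel fun i j => A i j < 0

/-- The number of edges. -/
def numEdges {n : ℕ} (G : SimpleGraph (Fin n)) : ℕ := G.edgeSet.ncard

/-- The number of triangles, i.e. of sets of three pairwise adjacent nodes. -/
def numTriangles {n : ℕ} (G : SimpleGraph (Fin n)) : ℕ :=
  {s : Finset (Fin n) | G.IsNClique 3 s}.ncard

/-- The real cube root, defined on all of `ℝ` (negative on negative numbers). -/
def cbrt (y : ℝ) : ℝ := if 0 ≤ y then y ^ (1 / 3 : ℝ) else -((-y) ^ (1 / 3 : ℝ))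

theorem cbrt_pow_three (y : ℝ) : cbrt y ^ 3 = y := by
  have key : ∀ z : ℝ, 0 ≤ z → (z ^ (1 / 3 : ℝ)) ^ 3 = z := by
    intro z hz
    rw [← Real.rpow_natCast, ← Real.rpow_mul hz]
    norm_num
  unfold cbrt
  split_ifs with h
  · exact key y h
  · have h2 := key (-y) (by linarith)
    rw [Odd.neg_pow (by decide), h2, neg_neg]

/-- The estimator `α̂ = (2N/n + ∛(6T - 8N³/n³)) / log n` computed from the graph `G`. -/
def alphaHat {n : ℕ} (G : SimpleGraph (Fin n)) : ℝ :=
  1 / Real.log n * (2 * (numEdges G : ℝ) / n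
    + cbrt (6 * (numTriangles G : ℝ) - 8 * (numEdges G : ℝ) ^ 3 / (n : ℝ) ^ 3))

/-- The estimator `β̂ = (2N/n - ∛(6T - 8N³/n³)) / log n` computed from the graph `G`. -/
def betaHat {n : ℕ} (G : SimpleGraph (Fin n)) : ℝ :=
  1 / Real.log n * (2 * (numEdges G : ℝ) / n
    - cbrt (6 * (numTriangles G : ℝ) - 8 * (numEdges G : ℝ) ^ 3 / (n : ℝ) ^ 3))

/-- The weight `ξ = log(β⁻/α⁻) / log(α⁺/β⁺)`. -/
def xi (αPos βPos αNeg βNeg : ℝ) : ℝ :=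
  Real.log (βNeg / αNeg) / Real.log (αPos / βPos)

/-- The plug-in estimator `ξ̂ = log(β̂⁻/α̂⁻) / log(α̂⁺/β̂⁺)`. -/
def xiHat {n : ℕ} (A : Matrix (Fin n) (Fin n) ℤ) : ℝ :=
  xi (alphaHat (posGraph A)) (betaHat (posGraph A)) (alphaHat (negGraph A)) (betaHat (negGraph A))

/-- The expression defining `ξ̂` is meaningful: both logarithms have a positive argument
(in particular, as `a / 0 = 0`, no denominator inside them vanishes) and the logarithm in the
denominator is not zero. -/
def XiHatDefined {n : ℕ} (A : Matrix (Fin n) (Fin n) ℤ) : Prop :=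
  0 < betaHat (negGraph A) / alphaHat (negGraph A) ∧
    0 < alphaHat (posGraph A) / betaHat (posGraph A) ∧
    Real.log (alphaHat (posGraph A) / betaHat (posGraph A)) ≠ 0

end SignedSBM

end

/-!
Write `L = log n`, `δ = L ^ (-1 / 12)`, and let `N`, `T` be the numbers of edges and triangles of
one of the two graphs, whose edge probabilities are `α L / n` inside and `β L / n` between the
communities. With `a = (α + β) / 2` and `b = (α - β) / 2` these probabilities are the entries of
`(a + b x xᵀ) L / n`, and as `x` sums to zero, summing over pairs and over closed triples shows that
`2 N` and `6 T` have means close to `a n L` and `(a ^ 3 + b ^ 3) L ^ 3`. If both counts are within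
the factor `1 ± δ` of their means, then `u = 2 N / (n L)` and `v = 6 T / L ^ 3` are within `O(δ)` of
`a` and `a ^ 3 + b ^ 3`; the estimators are `u ± ∛(v - u ^ 3)`, and since `b ≠ 0` the cube root is
Lipschitz at `b ^ 3`, so that they are within `O(δ)` of `α` and `β`. Finally `ξ` is differentiable
at the true parameters.

It remains to show that the counts concentrate, with failure probability `O(n ^ (-2))`. The mean of
`T` is only of order `L ^ 3`, so second moments do not suffice. Both counts have the form "number of
members of a family of sets of edges that lie in the random edge set `S`", and everything follows
from one identity (`subsetExp_ite_subset_union`): the expectation of `1_{B ⊆ S} f(S)` is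
`ℙ(B ⊆ S)` times that of `f(S ∪ B)`.

* Upper tail: applied repeatedly, the identity bounds the moment of order `K` of the count by
  `(m + O(K ^ 2)) ^ K`, where `m` is the mean (`SparseFamily.subsetExp_pow_le`). Markov's inequality
  with `K` about `L ^ (5 / 4)` gives the bound.
* Lower tail: together with Harris' inequality the identity gives Janson's differential inequality
  for the Laplace transform of the count (`SparseFamily.le_subsetExp_mul_exp`), hence a Gaussian
  bound (`SparseFamily.lower_tail`).

That pairs and triples satisfy the sparsity needed here is `sparseFamily_pairs` and
`sparseFamily_triples`; `measureReal_edgeFinset_le` transfers the bounds to the random matrix.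
-/

namespace SignedSBM

/-! ### Random subsets with independent membership -/

section RandomSubset

variable {V : Type*} [Fintype V] [DecidableEq V]

/-- The probability that the random subset of `V` that contains each `e` independently with
probability `p e` equals `S`. -/
noncomputable def subsetWeight (p : V → ℝ) (S : Finset V) : ℝ :=
  ∏ e, if e ∈ S then p e else 1 - p e

/-- The expectation of `f S`, where the random subset `S` of `V` contains each `e` independently
with probability `p e`. -/
noncomputable def subsetExp (p : V → ℝ) (f : Finset V → ℝ) : ℝ :=
  ∑ S, subsetWeight p S * f S

/-- The conditional probability that the random subset contains `B`, given that it contains `F`. -/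
noncomputable def condProb (p : V → ℝ) (F B : Finset V) : ℝ :=
  ∏ e ∈ B, if e ∈ F then 1 else p e

variable {p : V → ℝ}

lemma subsetWeight_nonneg (hp0 : ∀ e, 0 ≤ p e) (hp1 : ∀ e, p e ≤ 1) (S : Finset V) :
    0 ≤ subsetWeight p S :=
  Finset.prod_nonneg fun e _ => by split_ifs <;> linarith [hp0 e, hp1 e]

lemma sum_subsetWeight : ∑ S, subsetWeight p S = 1 := by
  have h := Finset.prod_add p (fun e => 1 - p e) Finset.univ
  simp only [add_sub_cancel, Finset.prod_const_one, Finset.powerset_univ] at h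
  rw [h]
  refine Finset.sum_congr rfl fun S _ => ?_
  rw [subsetWeight, Finset.prod_ite]
  congr 2 <;> ext e <;> simp

lemma subsetWeight_mul (S T : Finset V) :
    subsetWeight p S * subsetWeight p T = subsetWeight p (S ⊓ T) * subsetWeight p (S ⊔ T) := by
  simp only [subsetWeight, ← Finset.prod_mul_distrib]
  refine Finset.prod_congr rfl fun e _ => ?_
  by_cases h1 : e ∈ S <;> by_cases h2 : e ∈ T <;> simp [h1, h2, mul_comm]

lemma subsetExp_mono (hp0 : ∀ e, 0 ≤ p e) (hp1 : ∀ e, p e ≤ 1) {f g : Finset V → ℝ}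
    (h : ∀ S, f S ≤ g S) : subsetExp p f ≤ subsetExp p g :=
  Finset.sum_le_sum fun S _ => mul_le_mul_of_nonneg_left (h S) (subsetWeight_nonneg hp0 hp1 S)

lemma subsetExp_const (c : ℝ) : subsetExp p (fun _ => c) = c := by
  rw [subsetExp, ← Finset.sum_mul, sum_subsetWeight, one_mul]

lemma subsetExp_const_mul (c : ℝ) (f : Finset V → ℝ) :
    subsetExp p (fun S => c * f S) = c * subsetExp p f := by
  simp only [subsetExp, Finset.mul_sum]
  exact Finset.sum_congr rfl fun S _ => by ring

lemma subsetExp_sub (f g : Finset V → ℝ) :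
    subsetExp p (fun S => f S - g S) = subsetExp p f - subsetExp p g := by
  simp only [subsetExp, mul_sub, Finset.sum_sub_distrib]

lemma subsetExp_sum {ι : Type*} (I : Finset ι) (f : ι → Finset V → ℝ) :
    subsetExp p (fun S => ∑ i ∈ I, f i S) = ∑ i ∈ I, subsetExp p (f i) := by
  simp only [subsetExp, Finset.mul_sum]
  exact Finset.sum_comm

lemma subsetExp_ite_mem (e : V) (f : Finset V → ℝ) :
    subsetExp p (fun S => if e ∈ S then f S else 0) =
      p e * subsetExp p (fun S => f (insert e S)) := by
  -- each set without `e` is paired with the set obtained by adding `e`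
  have key : ∀ g : Finset V → ℝ, ∑ S, g S =
      ∑ S ∈ (Finset.univ.erase e).powerset, (g S + g (insert e S)) := by
    intro g
    rw [Finset.sum_add_distrib, ← Finset.sum_powerset_insert (Finset.notMem_erase e _),
      Finset.insert_erase (Finset.mem_univ e), Finset.powerset_univ]
  rw [subsetExp, subsetExp, key, key, Finset.mul_sum]
  refine Finset.sum_congr rfl fun S hS => ?_
  have he : e ∉ S := fun h => by simpa using Finset.mem_powerset.1 hS h
  have hw : ∀ T : Finset V, subsetWeight p T = (if e ∈ T then p e else 1 - p e) *
      ∏ x ∈ Finset.univ.erase e, if x ∈ T then p x else 1 - p x := fun T =>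
    (Finset.mul_prod_erase _ _ (Finset.mem_univ e)).symm
  have hprod : (∏ x ∈ Finset.univ.erase e, if x ∈ insert e S then p x else 1 - p x) =
      ∏ x ∈ Finset.univ.erase e, if x ∈ S then p x else 1 - p x := by
    refine Finset.prod_congr rfl fun x hx => ?_
    have : x ≠ e := Finset.ne_of_mem_erase hx
    simp [this]
  rw [hw S, hw (insert e S), hprod]
  simp only [he, if_false, Finset.mem_insert_self, if_true, Finset.insert_idem]
  ring

lemma subsetExp_ite_subset (B : Finset V) (f : Finset V → ℝ) :
    subsetExp p (fun S => if B ⊆ S then f S else 0) =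
      (∏ e ∈ B, p e) * subsetExp p (fun S => f (S ∪ B)) := by
  induction B using Finset.induction_on generalizing f with
  | empty => simp
  | insert a B ha ih =>
    have h1 : (fun S => if insert a B ⊆ S then f S else 0) =
        fun S => if a ∈ S then (if B ⊆ S then f S else 0) else 0 := by
      funext S
      by_cases h : a ∈ S <;> simp [Finset.insert_subset_iff, h]
    have h2 : (fun S => if B ⊆ insert a S then f (insert a S) else 0) =
        fun S => if B ⊆ S then f (insert a S) else 0 := by
      funext S
      simp only [Finset.subset_insert_iff_of_notMem ha]
    rw [h1, subsetExp_ite_mem, h2, ih, Finset.prod_insert ha, mul_assoc]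
    simp only [Finset.union_insert]

/-- Conditioning on `B ⊆ S ∪ F` amounts to adding `B` to the set. -/
lemma subsetExp_ite_subset_union (F B : Finset V) (f : Finset V → ℝ) :
    subsetExp p (fun S => if B ⊆ S ∪ F then f (S ∪ F) else 0) =
      condProb p F B * subsetExp p (fun S => f (S ∪ (F ∪ B))) := by
  have h1 : (fun S => if B ⊆ S ∪ F then f (S ∪ F) else 0) =
      fun S => if B \ F ⊆ S then f (S ∪ F) else 0 := by
    funext S
    have : B ⊆ S ∪ F ↔ B \ F ⊆ S := by grind
    simp only [this]
  have h2 : ∀ S : Finset V, S ∪ B \ F ∪ F = S ∪ (F ∪ B) := by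
    intro S
    ext e
    simp only [Finset.mem_union, Finset.mem_sdiff]
    tauto
  rw [h1, subsetExp_ite_subset (B \ F) (fun S => f (S ∪ F))]
  simp only [h2]
  congr 1
  rw [condProb, Finset.prod_ite, Finset.prod_const_one, one_mul]
  congr 1
  ext e
  simp

/-- **Harris' inequality**: an increasing and a decreasing function of the random subset are
negatively correlated. -/
lemma subsetExp_mul_le (hp0 : ∀ e, 0 ≤ p e) (hp1 : ∀ e, p e ≤ 1) {f g : Finset V → ℝ}
    (hf0 : ∀ S, 0 ≤ f S) (hf : Monotone f) (hg1 : ∀ S, g S ≤ 1) (hg : Antitone g) :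
    subsetExp p (fun S => f S * g S) ≤ subsetExp p f * subsetExp p g := by
  have h := fkg (μ := subsetWeight p) (f := f) (g := fun S => 1 - g S)
    (fun S => subsetWeight_nonneg hp0 hp1 S) hf0 (fun S => sub_nonneg.2 (hg1 S)) hf
    (fun S T hST => sub_le_sub_left (hg hST) 1) (fun S T => (subsetWeight_mul S T).le)
  rw [sum_subsetWeight, one_mul] at h
  have e1 : ∑ S, subsetWeight p S * (1 - g S) = 1 - subsetExp p g := by
    simp only [mul_sub, mul_one, Finset.sum_sub_distrib, sum_subsetWeight, subsetExp]
  have e2 : ∑ S, subsetWeight p S * (f S * (1 - g S)) =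
      subsetExp p f - subsetExp p (fun S => f S * g S) := by
    simp only [mul_sub, mul_one, Finset.sum_sub_distrib, subsetExp]
  rw [e1, e2] at h
  have e3 : ∑ S, subsetWeight p S * f S = subsetExp p f := rfl
  rw [e3] at h
  linarith

end RandomSubset

/-! ### Tails of the number of members of a family contained in a random subset -/

section InclusionCount

variable {V ι : Type*} {p : V → ℝ} {I : Finset ι} {B : ι → Finset V}

/-- The expectation of the number of sets `B i`, `i ∈ I`, contained in the random subset. -/
noncomputable def inclMean (p : V → ℝ) (I : Finset ι) (B : ι → Finset V) : ℝ :=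
  ∑ i ∈ I, ∏ e ∈ B i, p e

lemma inclMean_nonneg (hp0 : ∀ e, 0 ≤ p e) : 0 ≤ inclMean p I B :=
  Finset.sum_nonneg fun _ _ => Finset.prod_nonneg fun e _ => hp0 e

variable [DecidableEq V]

/-- The number of members of the family `(B i)`, `i ∈ I`, that are contained in `S`. -/
noncomputable def inclCount (I : Finset ι) (B : ι → Finset V) (S : Finset V) : ℝ :=
  ∑ i ∈ I, if B i ⊆ S then 1 else 0

/-- A family of sets of size at most three is sparse if conditioning on the presence of `F` raises
the expected number of present members meeting `F` to at most `18 * F.card ^ 2`. The constant `18`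
is what the pairs and the triangles of the random graph need. -/
structure SparseFamily (p : V → ℝ) (I : Finset ι) (B : ι → Finset V) : Prop where
  card_le : ∀ i ∈ I, (B i).card ≤ 3
  sum_condProb_le : ∀ F : Finset V,
    ∑ i ∈ I with ¬ Disjoint (B i) F, condProb p F (B i) ≤ 18 * (F.card : ℝ) ^ 2

lemma inclCount_nonneg (S : Finset V) : 0 ≤ inclCount I B S :=
  Finset.sum_nonneg fun i _ => by split_ifs <;> norm_num

lemma inclCount_mono : Monotone (inclCount I B) := fun S T hST =>
  Finset.sum_le_sum fun i _ => by
    by_cases h : B i ⊆ S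
    · simp [h, h.trans hST]
    · simp only [h, if_false]
      split_ifs <;> norm_num

lemma condProb_nonneg (hp0 : ∀ e, 0 ≤ p e) (F C : Finset V) : 0 ≤ condProb p F C :=
  Finset.prod_nonneg fun e _ => by
    split_ifs
    · exact zero_le_one
    · exact hp0 e

lemma condProb_of_disjoint {F C : Finset V} (h : Disjoint C F) :
    condProb p F C = ∏ e ∈ C, p e :=
  Finset.prod_congr rfl fun e he => by simp [Finset.disjoint_left.1 h he]

lemma SparseFamily.sum_condProb_le_mean (hB : SparseFamily p I B) (hp0 : ∀ e, 0 ≤ p e)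
    (F : Finset V) :
    ∑ i ∈ I, condProb p F (B i) ≤ inclMean p I B + 18 * (F.card : ℝ) ^ 2 := by
  rw [← Finset.sum_filter_add_sum_filter_not I (fun i => Disjoint (B i) F)]
  refine add_le_add ?_ (hB.sum_condProb_le F)
  rw [Finset.sum_congr rfl fun i hi => condProb_of_disjoint (Finset.mem_filter.1 hi).2]
  exact Finset.sum_le_sum_of_subset_of_nonneg (Finset.filter_subset _ _)
    fun i _ _ => Finset.prod_nonneg fun e _ => hp0 e

variable [Fintype V]

/-- Each factor of the `k`-th moment of the count forces one more member of the family into the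
random set; the members forced so far cover at most `3 * K` elements, which raises the
expectation of the next factor only slightly. -/
lemma SparseFamily.subsetExp_pow_le (hB : SparseFamily p I B) (hp0 : ∀ e, 0 ≤ p e)
    (K k : ℕ) (F : Finset V) (hF : F.card + 3 * k ≤ 3 * K) :
    subsetExp p (fun S => inclCount I B (S ∪ F) ^ k) ≤
      (inclMean p I B + 162 * (K : ℝ) ^ 2) ^ k := by
  induction k generalizing F with
  | zero => simp [subsetExp_const]
  | succ k ih =>
    have h1 : (fun S => inclCount I B (S ∪ F) ^ (k + 1)) = fun S =>
        ∑ i ∈ I, if B i ⊆ S ∪ F then inclCount I B (S ∪ F) ^ k else 0 := by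
      funext S
      rw [pow_succ', inclCount, Finset.sum_mul]
      simp only [ite_mul, one_mul, zero_mul]
    have hΛ : 0 ≤ inclMean p I B + 162 * (K : ℝ) ^ 2 :=
      add_nonneg (inclMean_nonneg hp0) (by positivity)
    have h2 : ∑ i ∈ I, condProb p F (B i) ≤ inclMean p I B + 162 * (K : ℝ) ^ 2 := by
      refine (hB.sum_condProb_le_mean hp0 F).trans (add_le_add_right ?_ _)
      have : (F.card : ℝ) ≤ 3 * K := by
        have : F.card ≤ 3 * K := by omega
        exact_mod_cast this
      nlinarith [(Nat.cast_nonneg F.card : (0 : ℝ) ≤ F.card)]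
    rw [h1, subsetExp_sum, pow_succ']
    refine le_trans ?_ (mul_le_mul_of_nonneg_right h2 (pow_nonneg hΛ k))
    rw [Finset.sum_mul]
    refine Finset.sum_le_sum fun i hi => ?_
    rw [subsetExp_ite_subset_union F (B i) (fun S => inclCount I B S ^ k)]
    refine mul_le_mul_of_nonneg_left (ih _ ?_) (condProb_nonneg hp0 _ _)
    have := Finset.card_union_le F (B i)
    have := hB.card_le i hi
    omega

lemma SparseFamily.upper_tail (hB : SparseFamily p I B) (hp0 : ∀ e, 0 ≤ p e)
    (hp1 : ∀ e, p e ≤ 1) (K : ℕ) {a : ℝ} (ha : 0 < a) :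
    subsetExp p (fun S => if a < inclCount I B S then 1 else 0) ≤
      ((inclMean p I B + 162 * (K : ℝ) ^ 2) / a) ^ K := by
  have h := hB.subsetExp_pow_le hp0 K K ∅ (by simp)
  simp only [Finset.union_empty] at h
  rw [div_pow, le_div_iff₀' (pow_pos ha K), ← subsetExp_const_mul]
  refine le_trans (subsetExp_mono hp0 hp1 fun S => ?_) h
  split_ifs with hS
  · rw [mul_one]
    exact pow_le_pow_left₀ ha.le hS.le K
  · rw [mul_zero]
    exact pow_nonneg (inclCount_nonneg S) K

/-- Janson's differential inequality for the Laplace transform `subsetExp p (exp (-s T))` of the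
count `T`. Forcing `B i` into the random set raises `T` by at most the number `Y` of present
members that meet `B i`, and by Harris' inequality `Y` and `exp (-s T)` are negatively
correlated. -/
lemma SparseFamily.le_subsetExp_mul_exp (hB : SparseFamily p I B) (hp0 : ∀ e, 0 ≤ p e)
    (hp1 : ∀ e, p e ≤ 1) {s : ℝ} (hs : 0 ≤ s) :
    inclMean p I B * (1 - 162 * s) * subsetExp p (fun S => Real.exp (-s * inclCount I B S)) ≤
      subsetExp p (fun S => inclCount I B S * Real.exp (-s * inclCount I B S)) := by
  set Ψ := subsetExp p (fun S => Real.exp (-s * inclCount I B S)) with hΨ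
  have hΨ0 : 0 ≤ Ψ := Finset.sum_nonneg fun S _ =>
    mul_nonneg (subsetWeight_nonneg hp0 hp1 S) (Real.exp_pos _).le
  have h1 : (fun S => inclCount I B S * Real.exp (-s * inclCount I B S)) = fun S =>
      ∑ i ∈ I, if B i ⊆ S then Real.exp (-s * inclCount I B S) else 0 := by
    funext S
    nth_rw 1 [inclCount]
    rw [Finset.sum_mul]
    simp only [ite_mul, one_mul, zero_mul]
  rw [h1, subsetExp_sum, inclMean, mul_assoc, Finset.sum_mul]
  refine Finset.sum_le_sum fun i hi => ?_
  rw [subsetExp_ite_subset (B i) (fun S => Real.exp (-s * inclCount I B S))]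
  refine mul_le_mul_of_nonneg_left ?_ (Finset.prod_nonneg fun e _ => hp0 e)
  set Y : Finset V → ℝ := fun S =>
    inclCount {j ∈ I | ¬ Disjoint (B j) (B i)} B (S ∪ B i) with hY
  have hYmono : Monotone Y := fun S T hST =>
    inclCount_mono (Finset.union_subset_union_left hST)
  have hY0 : ∀ S, 0 ≤ Y S := fun S => inclCount_nonneg _
  have hEY : subsetExp p Y ≤ 162 := by
    have e : Y = fun S => ∑ j ∈ I with ¬ Disjoint (B j) (B i),
        if B j ⊆ S ∪ B i then (1 : ℝ) else 0 := rfl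
    rw [e, subsetExp_sum]
    have e2 : ∀ j, subsetExp p (fun S => if B j ⊆ S ∪ B i then (1 : ℝ) else 0) =
        condProb p (B i) (B j) := fun j => by
      rw [subsetExp_ite_subset_union (B i) (B j) (fun _ => 1), subsetExp_const, mul_one]
    rw [Finset.sum_congr rfl fun j _ => e2 j]
    refine (hB.sum_condProb_le (B i)).trans ?_
    have : ((B i).card : ℝ) ≤ 3 := by exact_mod_cast hB.card_le i hi
    nlinarith [(Nat.cast_nonneg (B i).card : (0 : ℝ) ≤ (B i).card)]
  have hcount : ∀ S, inclCount I B (S ∪ B i) ≤ inclCount I B S + Y S := by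
    intro S
    have e : Y S = ∑ j ∈ I, if ¬ Disjoint (B j) (B i) then
        (if B j ⊆ S ∪ B i then (1 : ℝ) else 0) else 0 := by
      rw [hY, ← Finset.sum_filter]
      rfl
    rw [e, inclCount, inclCount, ← Finset.sum_add_distrib]
    refine Finset.sum_le_sum fun j _ => ?_
    by_cases hd : Disjoint (B j) (B i)
    · have : B j ⊆ S ∪ B i ↔ B j ⊆ S := by
        refine ⟨fun h => ?_, fun h => h.trans Finset.subset_union_left⟩
        exact Disjoint.left_le_of_le_sup_right h hd
      simp [hd, this]
    · simp only [hd, not_false_eq_true, if_true, le_add_iff_nonneg_left]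
      split_ifs <;> norm_num
  have hHarris : subsetExp p (fun S => Y S * Real.exp (-s * inclCount I B S)) ≤ 162 * Ψ := by
    refine (subsetExp_mul_le hp0 hp1 hY0 hYmono (fun S => ?_) fun S T hST => ?_).trans
      (mul_le_mul_of_nonneg_right hEY hΨ0)
    · rw [Real.exp_le_one_iff]
      nlinarith [inclCount_nonneg (I := I) (B := B) S]
    · rw [Real.exp_le_exp]
      nlinarith [inclCount_mono (I := I) (B := B) hST]
  calc (1 - 162 * s) * Ψ = Ψ - s * (162 * Ψ) := by ring
    _ ≤ Ψ - s * subsetExp p (fun S => Y S * Real.exp (-s * inclCount I B S)) :=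
        sub_le_sub_left (mul_le_mul_of_nonneg_left hHarris hs) _
    _ = subsetExp p (fun S => Real.exp (-s * inclCount I B S) -
          s * (Y S * Real.exp (-s * inclCount I B S))) := by
        rw [subsetExp_sub, subsetExp_const_mul]
    _ ≤ subsetExp p (fun S => Real.exp (-s * inclCount I B (S ∪ B i))) := by
        refine subsetExp_mono hp0 hp1 fun S => ?_
        have h2 : Real.exp (-s * inclCount I B S) * Real.exp (-s * Y S) ≤
            Real.exp (-s * inclCount I B (S ∪ B i)) := by
          rw [← Real.exp_add, Real.exp_le_exp]
          nlinarith [hcount S]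
        have h3 := Real.add_one_le_exp (-s * Y S)
        nlinarith [Real.exp_pos (-s * inclCount I B S)]

lemma SparseFamily.subsetExp_exp_le (hB : SparseFamily p I B) (hp0 : ∀ e, 0 ≤ p e)
    (hp1 : ∀ e, p e ≤ 1) {s : ℝ} (hs : 0 ≤ s) :
    subsetExp p (fun S => Real.exp (-s * inclCount I B S)) ≤
      Real.exp (-(inclMean p I B * s) + 81 * inclMean p I B * s ^ 2) := by
  set m := inclMean p I B with hm
  set Ψ : ℝ → ℝ := fun s => subsetExp p (fun S => Real.exp (-s * inclCount I B S)) with hΨ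
  set X : ℝ → ℝ := fun s =>
    subsetExp p (fun S => inclCount I B S * Real.exp (-s * inclCount I B S)) with hX
  have hderΨ : ∀ s, HasDerivAt Ψ (-X s) s := by
    intro s
    have : HasDerivAt Ψ (∑ S, subsetWeight p S *
        (Real.exp (-s * inclCount I B S) * (-1 * inclCount I B S))) s := by
      refine HasDerivAt.fun_sum fun S _ => HasDerivAt.const_mul _ ?_
      exact ((hasDerivAt_neg s).mul_const _).exp
    convert this using 1
    change -(∑ S, subsetWeight p S * (inclCount I B S * Real.exp (-s * inclCount I B S))) = _
    rw [← Finset.sum_neg_distrib]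
    exact Finset.sum_congr rfl fun S _ => by ring
  set q : ℝ → ℝ := fun s => Real.exp (m * s - 81 * m * s ^ 2) with hq
  have hderq : ∀ s, HasDerivAt q (q s * (m - 162 * m * s)) s := by
    intro s
    have h1 : HasDerivAt (fun s : ℝ => m * s - 81 * m * s ^ 2) (m - 162 * m * s) s := by
      refine (((hasDerivAt_id' s).const_mul m).fun_sub
        ((hasDerivAt_pow 2 s).const_mul (81 * m))).congr_deriv ?_
      norm_num
      ring
    exact h1.exp
  have hder : ∀ s, HasDerivAt (fun s => Ψ s * q s)
      (-X s * q s + Ψ s * (q s * (m - 162 * m * s))) s := fun s => (hderΨ s).mul (hderq s)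
  have hanti : AntitoneOn (fun s => Ψ s * q s) (Set.Ici 0) := by
    refine antitoneOn_of_deriv_nonpos (convex_Ici 0)
      (fun s _ => (hder s).continuousAt.continuousWithinAt)
      (fun s _ => (hder s).differentiableAt.differentiableWithinAt) fun s hs => ?_
    rw [interior_Ici] at hs
    rw [(hder s).deriv]
    have h := hB.le_subsetExp_mul_exp hp0 hp1 (le_of_lt hs)
    have hq0 : 0 < q s := Real.exp_pos _
    have h' : m * (1 - 162 * s) * Ψ s ≤ X s := h
    nlinarith
  have h := hanti (Set.mem_Ici.2 le_rfl) (Set.mem_Ici.2 hs) hs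
  have h0 : Ψ 0 * q 0 = 1 := by simp [hΨ, hq, subsetExp_const]
  simp only [h0] at h
  have he : Real.exp (-(m * s) + 81 * m * s ^ 2) = (q s)⁻¹ := by
    rw [hq, ← Real.exp_neg]
    congr 1
    ring
  rw [he, ← one_div, le_div_iff₀ (Real.exp_pos _)]
  exact h

lemma SparseFamily.lower_tail (hB : SparseFamily p I B) (hp0 : ∀ e, 0 ≤ p e)
    (hp1 : ∀ e, p e ≤ 1) {δ : ℝ} (hδ : 0 ≤ δ) :
    subsetExp p (fun S => if inclCount I B S < (1 - δ) * inclMean p I B then 1 else 0) ≤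
      Real.exp (-(δ ^ 2 * inclMean p I B / 324)) := by
  set m := inclMean p I B with hm
  -- the value of `s` that minimizes `-s δ m + 81 m s ^ 2`
  set s := δ / 162 with hs
  have hs0 : 0 ≤ s := by positivity
  have h1 : subsetExp p (fun S => if inclCount I B S < (1 - δ) * m then 1 else 0) ≤
      Real.exp (s * ((1 - δ) * m)) * subsetExp p (fun S => Real.exp (-s * inclCount I B S)) := by
    rw [← subsetExp_const_mul]
    refine subsetExp_mono hp0 hp1 fun S => ?_
    rw [← Real.exp_add]
    split_ifs with hS
    · rw [Real.one_le_exp_iff]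
      nlinarith
    · exact (Real.exp_pos _).le
  refine h1.trans ((mul_le_mul_of_nonneg_left (hB.subsetExp_exp_le hp0 hp1 hs0)
    (Real.exp_pos _).le).trans ?_)
  rw [← Real.exp_add, Real.exp_le_exp, hs]
  apply le_of_eq
  ring

end InclusionCount

/-! ### The families of edges and triangles -/

section PairsAndTriples

variable {W : Type*}

/-- The edge between the two vertices of a pair, as a set of edges. -/
def pairEdges (t : W × W) : Finset (Sym2 W) := {s(t.1, t.2)}

lemma prod_pairEdges (f : Sym2 W → ℝ) (t : W × W) :
    ∏ e ∈ pairEdges t, f e = f s(t.1, t.2) :=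
  Finset.prod_singleton _ _

variable [Fintype W]

lemma sum_sum_sum_mul_le (a : W → W → ℝ) (ha : ∀ i j, 0 ≤ a i j) :
    ∑ i, ∑ j, ∑ k, a i j * a j k ≤ (∑ i, ∑ j, a i j) ^ 2 := by
  rw [sq, Finset.sum_mul]
  refine Finset.sum_le_sum fun i _ => ?_
  rw [Finset.sum_mul]
  refine Finset.sum_le_sum fun j _ => ?_
  rw [← Finset.mul_sum]
  exact mul_le_mul_of_nonneg_left (Finset.single_le_sum (f := fun j => ∑ k, a j k)
    (fun j _ => Finset.sum_nonneg fun k _ => ha j k) (Finset.mem_univ j)) (ha i j)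

lemma sum_sum_add_mul (a b : ℝ) {x : W → ℝ} (hx : ∑ i, x i = 0) :
    ∑ i, ∑ j, (a + b * (x i * x j)) = (Fintype.card W : ℝ) ^ 2 * a := by
  simp only [Finset.sum_add_distrib, ← Finset.mul_sum, hx]
  simp
  ring

/-- The matrix `a + b x xᵀ` with `x ⊥ 1` has the nonzero eigenvalues `a n` and `b n`; this is the
trace of its cube. -/
lemma sum_sum_sum_add_mul (a b : ℝ) {x : W → ℝ} (hx : ∑ i, x i = 0) (hx2 : ∀ i, x i * x i = 1) :
    ∑ i, ∑ j, ∑ k, (a + b * (x i * x j)) * (a + b * (x j * x k)) * (a + b * (x i * x k)) =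
      (Fintype.card W : ℝ) ^ 3 * (a ^ 3 + b ^ 3) := by
  have h : ∀ i j k, (a + b * (x i * x j)) * (a + b * (x j * x k)) * (a + b * (x i * x k)) =
      (a ^ 3 + b ^ 3) + (a ^ 2 * b + a * b ^ 2) * (x i * x j) +
        ((a ^ 2 * b + a * b ^ 2) * x j + (a ^ 2 * b + a * b ^ 2) * x i) * x k := by
    intro i j k
    linear_combination (a * b ^ 2 * x i * x k + b ^ 3 * x i * x i * x k * x k) * hx2 j +
      (a * b ^ 2 * x j * x k + b ^ 3 * x k * x k) * hx2 i + (a * b ^ 2 * x i * x j + b ^ 3) * hx2 k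
  simp only [h, Finset.sum_add_distrib, ← Finset.mul_sum, hx]
  simp only [Finset.sum_const, Finset.card_univ, nsmul_eq_mul, ← Finset.mul_sum, hx]
  simp
  ring

variable [DecidableEq W]

/-- The ordered pairs of distinct vertices. -/
def vertexPairs (W : Type*) [Fintype W] [DecidableEq W] : Finset (W × W) :=
  {t | t.1 ≠ t.2}

/-- The ordered triples of distinct vertices. -/
def vertexTriples (W : Type*) [Fintype W] [DecidableEq W] : Finset (W × W × W) :=
  {t | t.1 ≠ t.2.1 ∧ t.2.1 ≠ t.2.2 ∧ t.1 ≠ t.2.2}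

/-- The three edges of the triangle on a triple of vertices. -/
def tripleEdges (t : W × W × W) : Finset (Sym2 W) :=
  {s(t.1, t.2.1), s(t.2.1, t.2.2), s(t.1, t.2.2)}

lemma prod_tripleEdges (f : Sym2 W → ℝ) {t : W × W × W} (ht : t ∈ vertexTriples W) :
    ∏ e ∈ tripleEdges t, f e = f s(t.1, t.2.1) * f s(t.2.1, t.2.2) * f s(t.1, t.2.2) := by
  obtain ⟨i, j, k⟩ := t
  simp only [vertexTriples, Finset.mem_filter, Finset.mem_univ, true_and] at ht
  obtain ⟨hij, hjk, hik⟩ := ht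
  have h1 : s(i, j) ∉ ({s(j, k), s(i, k)} : Finset (Sym2 W)) := by
    simp only [Finset.mem_insert, Finset.mem_singleton, Sym2.eq_iff]
    grind
  have h2 : s(j, k) ∉ ({s(i, k)} : Finset (Sym2 W)) := by
    simp only [Finset.mem_singleton, Sym2.eq_iff]
    grind
  simp only [tripleEdges]
  rw [Finset.prod_insert h1, Finset.prod_insert h2, Finset.prod_singleton, mul_assoc]

lemma sum_sum_ite_mem_le (F : Finset (Sym2 W)) :
    ∑ i : W, ∑ j : W, (if s(i, j) ∈ F then (1 : ℝ) else 0) ≤ 2 * F.card := by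
  rw [← Fintype.sum_prod_type' (f := fun i j : W => if s(i, j) ∈ F then (1 : ℝ) else 0),
    Finset.sum_boole]
  have h : (Finset.univ.filter fun t : W × W => s(t.1, t.2) ∈ F).card ≤ 2 * F.card := by
    refine Finset.card_le_mul_card_image_of_maps_to (f := fun t : W × W => s(t.1, t.2))
      (fun t ht => (Finset.mem_filter.1 ht).2) 2 fun e _ => ?_
    induction e using Sym2.ind with
    | _ a b =>
      refine (Finset.card_le_card (t := {(a, b), (b, a)}) fun t ht => ?_).trans Finset.card_le_two
      simpa [Prod.ext_iff] using (Finset.mem_filter.1 ht).2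
  exact_mod_cast h

variable {p : Sym2 W → ℝ}

lemma sparseFamily_pairs : SparseFamily p (vertexPairs W) pairEdges where
  card_le t _ := by simp [pairEdges]
  sum_condProb_le F := by
    have h1 : ∑ t ∈ vertexPairs W with ¬ Disjoint (pairEdges t) F, condProb p F (pairEdges t) ≤
        ∑ t : W × W, if s(t.1, t.2) ∈ F then (1 : ℝ) else 0 := by
      rw [← Finset.sum_filter]
      refine (Finset.sum_congr rfl fun t ht => ?_).trans_le
        (Finset.sum_le_sum_of_subset_of_nonneg (fun t ht => ?_) fun _ _ _ => zero_le_one)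
      · have := (Finset.mem_filter.1 ht).2
        simp only [pairEdges, Finset.disjoint_singleton_left, not_not] at this
        rw [condProb, prod_pairEdges, if_pos this]
      · have := (Finset.mem_filter.1 ht).2
        simpa [pairEdges] using this
    rw [Fintype.sum_prod_type] at h1
    refine h1.trans ((sum_sum_ite_mem_le F).trans ?_)
    have : (F.card : ℝ) ≤ (F.card : ℝ) ^ 2 := by exact_mod_cast Nat.le_self_pow two_ne_zero _
    nlinarith [(Nat.cast_nonneg F.card : (0 : ℝ) ≤ F.card)]

/-- A triangle that shares exactly one edge with `F` needs two further edges, and such triangles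
number at most `6 * F.card * Fintype.card W`; one that shares two edges with `F` is determined
by them. -/
lemma sparseFamily_triples (hp0 : ∀ e, 0 ≤ p e) (hp1 : ∀ e, p e ≤ 1) {P : ℝ}
    (hP : ∀ i j, i ≠ j → p s(i, j) ≤ P) (hWP : Fintype.card W * P ^ 2 ≤ 1) :
    SparseFamily p (vertexTriples W) tripleEdges where
  card_le t _ := Finset.card_le_three
  sum_condProb_le F := by
    set a : W → W → ℝ := fun i j => if s(i, j) ∈ F then 1 else 0 with ha
    have ha0 : ∀ i j, 0 ≤ a i j := fun i j => by
      simp only [ha]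
      split_ifs <;> norm_num
    have hsymm : ∀ i j, a i j = a j i := fun i j => by simp only [ha, Sym2.eq_swap]
    set d := ∑ i, ∑ j, a i j with hd
    have h1 : ∑ t ∈ vertexTriples W with ¬ Disjoint (tripleEdges t) F,
          condProb p F (tripleEdges t) ≤
        ∑ t : W × W × W, (P ^ 2 * (a t.1 t.2.1 + a t.2.1 t.2.2 + a t.1 t.2.2) +
          (a t.1 t.2.1 * a t.2.1 t.2.2 + a t.2.1 t.2.2 * a t.2.2 t.1 +
            a t.2.2 t.1 * a t.1 t.2.1)) := by
      refine (Finset.sum_le_sum fun t ht => ?_).trans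
        (Finset.sum_le_sum_of_subset_of_nonneg (Finset.subset_univ _) fun t _ _ => ?_)
      · obtain ⟨hT, hF⟩ := Finset.mem_filter.1 ht
        rw [condProb, prod_tripleEdges _ hT]
        obtain ⟨i, j, k⟩ := t
        simp only [vertexTriples, Finset.mem_filter, Finset.mem_univ, true_and] at hT
        obtain ⟨hij, hjk, hik⟩ := hT
        simp only [tripleEdges, Finset.disjoint_insert_left, Finset.disjoint_singleton_left] at hF
        have a1 := hp0 s(i, j)
        have a2 := hp0 s(j, k)
        have a3 := hp0 s(i, k)
        have b1 := hp1 s(i, j)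
        have b2 := hp1 s(j, k)
        have b3 := hp1 s(i, k)
        have c1 := hP i j hij
        have c2 := hP j k hjk
        have c3 := hP i k hik
        simp only
        rw [hsymm k i]
        simp only [ha]
        by_cases m1 : s(i, j) ∈ F <;> by_cases m2 : s(j, k) ∈ F <;> by_cases m3 : s(i, k) ∈ F <;>
          simp only [m1, m2, m3, if_true, if_false, not_true, not_false_eq_true, and_true,
            and_false] at hF ⊢ <;> nlinarith [sq_nonneg P]
      · have := ha0 t.1 t.2.1
        have := ha0 t.2.1 t.2.2
        have := ha0 t.1 t.2.2
        have := ha0 t.2.2 t.1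
        positivity
    have e1 : ∑ i : W, ∑ j : W, ∑ _k : W, a i j = Fintype.card W * d := by
      simp [hd, Finset.mul_sum]
    have e2 : ∑ _i : W, ∑ j : W, ∑ k : W, a j k = Fintype.card W * d := by simp [hd]
    have e3 : ∑ i : W, ∑ _j : W, ∑ k : W, a i k = Fintype.card W * d := by
      simp [hd, Finset.mul_sum]
    have s1 : ∑ i, ∑ j, ∑ k, a i j * a j k ≤ d ^ 2 := sum_sum_sum_mul_le a ha0
    have s2 : ∑ i, ∑ j, ∑ k, a j k * a k i ≤ d ^ 2 := by
      refine le_trans (le_of_eq ?_) s1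
      rw [Finset.sum_comm]
      exact Finset.sum_congr rfl fun j _ => Finset.sum_comm
    have s3 : ∑ i, ∑ j, ∑ k, a k i * a i j ≤ d ^ 2 := by
      refine le_trans (le_of_eq ?_) s1
      rw [Finset.sum_congr rfl fun i _ => Finset.sum_comm, Finset.sum_comm]
    simp only [Fintype.sum_prod_type, Finset.sum_add_distrib, ← Finset.mul_sum, e1, e2, e3] at h1
    simp only [← Finset.mul_sum] at s1
    have hd2 : d ≤ 2 * F.card := sum_sum_ite_mem_le F
    have hd0 : 0 ≤ d := Finset.sum_nonneg fun i _ => Finset.sum_nonneg fun j _ => ha0 i j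
    have hdd : d ^ 2 ≤ 4 * (F.card : ℝ) ^ 2 := by nlinarith
    have hF2 : (F.card : ℝ) ≤ (F.card : ℝ) ^ 2 := by
      exact_mod_cast Nat.le_self_pow two_ne_zero _
    have hWd : Fintype.card W * P ^ 2 * d ≤ 1 * d := mul_le_mul_of_nonneg_right hWP hd0
    linarith

variable {a b P : ℝ} {x : W → ℝ}

lemma abs_inclMean_pairs_sub_le (hx : ∑ i, x i = 0)
    (hp : ∀ i j, i ≠ j → p s(i, j) = a + b * (x i * x j))
    (h0 : ∀ i j, 0 ≤ a + b * (x i * x j)) (hP : ∀ i j, a + b * (x i * x j) ≤ P) :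
    |inclMean p (vertexPairs W) pairEdges - (Fintype.card W : ℝ) ^ 2 * a| ≤
      Fintype.card W * P := by
  have h1 : inclMean p (vertexPairs W) pairEdges =
      ∑ t : W × W with t.1 ≠ t.2, (a + b * (x t.1 * x t.2)) := by
    refine Finset.sum_congr rfl fun t ht => ?_
    rw [prod_pairEdges, hp _ _ (Finset.mem_filter.1 ht).2]
  have h2 := Finset.sum_filter_add_sum_filter_not (Finset.univ : Finset (W × W))
    (fun t => t.1 ≠ t.2) (fun t => a + b * (x t.1 * x t.2))
  rw [Fintype.sum_prod_type, sum_sum_add_mul a b hx, ← h1] at h2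
  have h3 : 0 ≤ ∑ t : W × W with ¬ t.1 ≠ t.2, (a + b * (x t.1 * x t.2)) :=
    Finset.sum_nonneg fun t _ => h0 _ _
  have h4 : ∑ t : W × W with ¬ t.1 ≠ t.2, (a + b * (x t.1 * x t.2)) ≤ Fintype.card W * P := by
    refine (Finset.sum_le_sum (g := fun _ => P) fun t _ => hP _ _).trans (le_of_eq ?_)
    rw [Finset.sum_filter, Fintype.sum_prod_type]
    simp
  rw [abs_le]
  constructor <;> linarith

lemma abs_inclMean_triples_sub_le (hx : ∑ i, x i = 0) (hx2 : ∀ i, x i * x i = 1)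
    (hp : ∀ i j, i ≠ j → p s(i, j) = a + b * (x i * x j))
    (h0 : ∀ i j, 0 ≤ a + b * (x i * x j)) (hP : ∀ i j, a + b * (x i * x j) ≤ P) :
    |inclMean p (vertexTriples W) tripleEdges - (Fintype.card W : ℝ) ^ 3 * (a ^ 3 + b ^ 3)| ≤
      3 * (Fintype.card W : ℝ) ^ 2 * P ^ 3 := by
  set q : W × W × W → ℝ := fun t => (a + b * (x t.1 * x t.2.1)) *
    (a + b * (x t.2.1 * x t.2.2)) * (a + b * (x t.1 * x t.2.2)) with hq
  have hq0 : ∀ t, 0 ≤ q t := fun t => mul_nonneg (mul_nonneg (h0 _ _) (h0 _ _)) (h0 _ _)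
  have hqP : ∀ t, q t ≤ P ^ 3 := fun t => by
    rw [pow_succ, sq]
    have hP0 : 0 ≤ P := (h0 t.1 t.1).trans (hP _ _)
    exact mul_le_mul (mul_le_mul (hP _ _) (hP _ _) (h0 _ _) hP0) (hP _ _) (h0 _ _) (by positivity)
  have h1 : inclMean p (vertexTriples W) tripleEdges = ∑ t ∈ vertexTriples W, q t := by
    refine Finset.sum_congr rfl fun t ht => ?_
    rw [prod_tripleEdges _ ht]
    simp only [vertexTriples, Finset.mem_filter, Finset.mem_univ, true_and] at ht
    rw [hp _ _ ht.1, hp _ _ ht.2.1, hp _ _ ht.2.2]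
  have h2 := Finset.sum_filter_add_sum_filter_not (Finset.univ : Finset (W × W × W))
    (fun t => t.1 ≠ t.2.1 ∧ t.2.1 ≠ t.2.2 ∧ t.1 ≠ t.2.2) q
  have h5 : ∑ t, q t = (Fintype.card W : ℝ) ^ 3 * (a ^ 3 + b ^ 3) := by
    simp only [Fintype.sum_prod_type, hq]
    exact sum_sum_sum_add_mul a b hx hx2
  have h6 : ∑ t : W × W × W with t.1 ≠ t.2.1 ∧ t.2.1 ≠ t.2.2 ∧ t.1 ≠ t.2.2, q t =
    ∑ t ∈ vertexTriples W, q t := rfl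
  rw [h5, h6, ← h1] at h2
  have h3 : 0 ≤ ∑ t : W × W × W with ¬ (t.1 ≠ t.2.1 ∧ t.2.1 ≠ t.2.2 ∧ t.1 ≠ t.2.2), q t :=
    Finset.sum_nonneg fun t _ => hq0 _
  have h4 : ∑ t : W × W × W with ¬ (t.1 ≠ t.2.1 ∧ t.2.1 ≠ t.2.2 ∧ t.1 ≠ t.2.2), q t ≤
      3 * (Fintype.card W : ℝ) ^ 2 * P ^ 3 := by
    have hle : ∑ t : W × W × W with ¬ (t.1 ≠ t.2.1 ∧ t.2.1 ≠ t.2.2 ∧ t.1 ≠ t.2.2), q t ≤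
        ∑ t : W × W × W, ((if t.1 = t.2.1 then P ^ 3 else 0) +
          (if t.2.1 = t.2.2 then P ^ 3 else 0) + if t.1 = t.2.2 then P ^ 3 else 0) := by
      rw [Finset.sum_filter]
      refine Finset.sum_le_sum fun t _ => ?_
      have := hq0 t
      have := hqP t
      by_cases e1 : t.1 = t.2.1 <;> by_cases e2 : t.2.1 = t.2.2 <;> by_cases e3 : t.1 = t.2.2 <;>
        simp only [e1, e2, e3, ne_eq, not_true, not_false_eq_true, and_true, and_false, if_true,
          if_false] <;> first | linarith | (split_ifs <;> linarith)
    refine hle.trans (le_of_eq ?_)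
    simp only [Finset.sum_add_distrib, Fintype.sum_prod_type]
    change (∑ i : W, ∑ j : W, ∑ _k : W, if i = j then P ^ 3 else 0) +
      (∑ _i : W, ∑ j : W, ∑ k : W, if j = k then P ^ 3 else 0) +
      (∑ i : W, ∑ _j : W, ∑ k : W, if i = k then P ^ 3 else 0) = _
    simp
    ring
  rw [abs_le]
  constructor <;> linarith

end PairsAndTriples

/-! ### Edge and triangle counts of a graph -/

section GraphCounts

variable {n : ℕ} (G : SimpleGraph (Fin n))

open Classical in
lemma inclCount_pairs_edgeFinset :
    inclCount (vertexPairs (Fin n)) pairEdges G.edgeFinset = 2 * (numEdges G : ℝ) := by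
  have h1 : inclCount (vertexPairs (Fin n)) pairEdges G.edgeFinset =
      ∑ i : Fin n, (G.degree i : ℝ) := by
    have h2 : inclCount (vertexPairs (Fin n)) pairEdges G.edgeFinset =
        ∑ t : Fin n × Fin n, if G.Adj t.1 t.2 then (1 : ℝ) else 0 := by
      rw [inclCount, vertexPairs, Finset.sum_filter]
      refine Finset.sum_congr rfl fun t _ => ?_
      by_cases h : t.1 = t.2 <;> simp [h, pairEdges]
    rw [h2, Fintype.sum_prod_type]
    refine Finset.sum_congr rfl fun i _ => ?_
    rw [Finset.sum_boole, ← SimpleGraph.card_neighborFinset_eq_degree]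
    congr 2
    ext j
    simp
  have h3 := G.sum_degrees_eq_twice_card_edges
  have h4 : numEdges G = G.edgeFinset.card := by
    rw [numEdges, ← SimpleGraph.coe_edgeFinset, Set.ncard_coe_finset]
  rw [h1, h4]
  exact_mod_cast h3

lemma card_orderings_of_triple {W : Type*} [Fintype W] [DecidableEq W] {a b c : W} (hab : a ≠ b)
    (hac : a ≠ c) (hbc : b ≠ c) :
    (Finset.univ.filter fun t : W × W × W =>
      ({t.1, t.2.1, t.2.2} : Finset W) = {a, b, c}).card = 6 := by
  have h : (Finset.univ.filter fun t : W × W × W =>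
      ({t.1, t.2.1, t.2.2} : Finset W) = {a, b, c}) =
      {(a, b, c), (a, c, b), (b, a, c), (b, c, a), (c, a, b), (c, b, a)} := by
    ext ⟨i, j, k⟩
    simp only [Finset.mem_filter, Finset.mem_univ, true_and, Finset.mem_insert,
      Finset.mem_singleton, Prod.mk.injEq, Finset.ext_iff]
    constructor
    · intro h
      have h1 := h a
      have h2 := h b
      have h3 := h c
      have h4 := h i
      have h5 := h j
      have h6 := h k
      grind
    · grind
  rw [h]
  repeat rw [Finset.card_insert_of_notMem (by simp [hab, hac, hbc, hab.symm, hac.symm, hbc.symm])]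
  rfl

open Classical in
lemma inclCount_triples_edgeFinset :
    inclCount (vertexTriples (Fin n)) tripleEdges G.edgeFinset = 6 * (numTriangles G : ℝ) := by
  set I : Finset (Fin n × Fin n × Fin n) :=
    {t | G.Adj t.1 t.2.1 ∧ G.Adj t.2.1 t.2.2 ∧ G.Adj t.1 t.2.2} with hI
  have h1 : inclCount (vertexTriples (Fin n)) tripleEdges G.edgeFinset = I.card := by
    rw [inclCount, Finset.sum_boole]
    congr 2
    ext t
    simp only [vertexTriples, tripleEdges, hI, Finset.mem_filter, Finset.mem_univ, true_and,
      Finset.insert_subset_iff, Finset.singleton_subset_iff, SimpleGraph.mem_edgeFinset,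
      SimpleGraph.mem_edgeSet]
    exact ⟨fun h => h.2, fun h => ⟨⟨h.1.ne, h.2.1.ne, h.2.2.ne⟩, h⟩⟩
  have h2 : numTriangles G = (Finset.univ.filter fun s => G.IsNClique 3 s).card := by
    rw [numTriangles, ← Set.ncard_coe_finset]
    congr 1
    ext s
    simp
  have h3 : I.card = 6 * (Finset.univ.filter fun s => G.IsNClique 3 s).card := by
    rw [Finset.card_eq_sum_card_fiberwise (f := fun t => ({t.1, t.2.1, t.2.2} : Finset (Fin n)))
      (t := Finset.univ.filter fun s => G.IsNClique 3 s)]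
    · rw [Finset.sum_const_nat (m := 6), mul_comm]
      intro s hs
      obtain ⟨a, b, c, hab, hac, hbc, rfl⟩ :=
        SimpleGraph.is3Clique_iff.1 (Finset.mem_filter.1 hs).2
      rw [← card_orderings_of_triple hab.ne hac.ne hbc.ne]
      congr 1
      ext ⟨i, j, k⟩
      simp only [hI, Finset.mem_filter, Finset.mem_univ, true_and, and_iff_right_iff_imp]
      intro h
      have hc : G.IsNClique 3 {i, j, k} := h ▸ (Finset.mem_filter.1 hs).2
      rw [SimpleGraph.is3Clique_triple_iff] at hc
      exact ⟨hc.1, hc.2.2, hc.2.1⟩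
    · intro t ht
      have ht' := (Finset.mem_filter.1 ht).2
      simp only [Finset.coe_filter, Finset.mem_univ, true_and, Set.mem_ofPred_eq]
      exact SimpleGraph.is3Clique_triple_iff.2 ⟨ht'.1, ht'.2.2, ht'.2.1⟩
  rw [h1, h2, h3]
  push_cast
  ring

end GraphCounts

/-! ### The law of the random edge set -/

section Law

/-- In the graph formed by the entries in `Q` of a random matrix with independent entries above the
diagonal, an event that depends on the edge set is at most as likely as for the random subset with
inclusion probabilities `p`. As `p` vanishes on the diagonal, the subset may range over all of
`Sym2 (Fin n)`. -/
lemma measureReal_edgeFinset_le {Ω : Type*} [MeasurableSpace Ω] {μ : Measure Ω}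
    [IsProbabilityMeasure μ] {n : ℕ} {A : Ω → Matrix (Fin n) (Fin n) ℤ}
    (hmeas : ∀ i j, Measurable fun ω => A ω i j)
    (hindep : iIndepFun (fun (e : {e : Fin n × Fin n // e.1 < e.2}) ω => A ω e.1.1 e.1.2) μ)
    {Q : Set ℤ} {G : Ω → SimpleGraph (Fin n)} [∀ ω, Fintype (G ω).edgeSet]
    (hG : ∀ ω i j, (G ω).Adj i j ↔ A ω i j ∈ Q) {p : Sym2 (Fin n) → ℝ}
    (hp : ∀ i j, p s(i, j) = μ.real {ω | A ω i j ∈ Q}) (R : Finset (Sym2 (Fin n)) → Prop)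
    [DecidablePred R] :
    μ.real {ω | R (G ω).edgeFinset} ≤ subsetExp p (fun S => if R S then 1 else 0) := by
  have hpdiag : ∀ i, p s(i, i) = 0 := fun i => by
    rw [hp]
    have : {ω | A ω i i ∈ Q} = ∅ := by
      ext ω
      simp [← hG]
    rw [this, measureReal_empty]
  have hp0 : ∀ e, 0 ≤ p e := fun e => by
    induction e using Sym2.ind with
    | _ i j => rw [hp]; exact measureReal_nonneg
  have hp1 : ∀ e, p e ≤ 1 := fun e => by
    induction e using Sym2.ind with
    | _ i j => rw [hp]; exact measureReal_le_one
  have hsingle : ∀ F : Finset (Sym2 (Fin n)),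
      μ.real {ω | (G ω).edgeFinset = F} ≤ subsetWeight p F := by
    intro F
    by_cases hF : ∃ i, s(i, i) ∈ F
    · obtain ⟨i, hi⟩ := hF
      have : {ω | (G ω).edgeFinset = F} = ∅ := by
        ext ω
        simp only [Set.mem_ofPred_eq, Set.mem_empty_iff_false, iff_false]
        rintro rfl
        simp at hi
      rw [this, measureReal_empty]
      exact subsetWeight_nonneg hp0 hp1 F
    · push Not at hF
      let sets : {e : Fin n × Fin n // e.1 < e.2} → Set ℤ := fun e =>
        if s(e.1.1, e.1.2) ∈ F then Q else Qᶜ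
      have hsub : {ω | (G ω).edgeFinset = F} ⊆
          ⋂ e ∈ (Finset.univ : Finset {e : Fin n × Fin n // e.1 < e.2}),
            (fun ω => A ω e.1.1 e.1.2) ⁻¹' sets e := by
        rintro ω rfl
        simp only [Set.mem_iInter, Set.mem_preimage, sets]
        intro e _
        by_cases h : A ω e.1.1 e.1.2 ∈ Q
        · simp [hG, h]
        · simp [hG, h]
      refine (measureReal_mono hsub).trans (le_of_eq ?_)
      rw [measureReal_def, hindep.measure_inter_preimage_eq_mul Finset.univ
        fun e _ => MeasurableSet.of_discrete, ENNReal.toReal_prod]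
      refine Fintype.prod_of_injective (fun e => s(e.1.1, e.1.2)) ?_ _ _ ?_ ?_
      · rintro ⟨⟨i, j⟩, hij⟩ ⟨⟨k, l⟩, hkl⟩ h
        simp only [Sym2.eq_iff] at h
        simp only [Subtype.mk.injEq, Prod.mk.injEq]
        simp only at hij hkl
        rcases h with h | ⟨rfl, rfl⟩
        · exact h
        · exact absurd hij hkl.asymm
      · intro e he
        induction e using Sym2.ind with
        | _ i j =>
          have hij : i = j := by
            rcases lt_trichotomy i j with h | h | h
            · exact absurd ⟨⟨(i, j), h⟩, rfl⟩ he
            · exact h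
            · exact absurd ⟨⟨(j, i), h⟩, Sym2.eq_swap⟩ he
          subst hij
          simp [hF i, hpdiag]
      · rintro ⟨⟨i, j⟩, hij⟩
        rw [← measureReal_def]
        simp only [sets]
        split_ifs with h
        · exact (hp i j).symm
        · rw [Set.preimage_compl,
            probReal_compl_eq_one_sub ((hmeas i j) MeasurableSet.of_discrete), hp]
          rfl
  have hcover : {ω | R (G ω).edgeFinset} ⊆
      ⋃ F ∈ (Finset.univ.filter R), {ω | (G ω).edgeFinset = F} := by
    intro ω hω
    simp only [Finset.mem_filter, Finset.mem_univ, true_and, Set.mem_iUnion]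
    exact ⟨_, hω, rfl⟩
  refine (measureReal_mono hcover (measure_ne_top _ _)).trans ((measureReal_biUnion_finset_le _ _).trans ?_)
  rw [Finset.sum_filter, subsetExp]
  refine Finset.sum_le_sum fun F _ => ?_
  split_ifs
  · rw [mul_one]
    exact hsingle F
  · rw [mul_zero]

lemma HasSignLaw.measureReal_pos {Ω : Type*} [MeasurableSpace Ω] {μ : Measure Ω}
    [IsProbabilityMeasure μ] {Y : Ω → ℤ} {r s : ℝ} (hY : Measurable Y) (h : HasSignLaw μ Y r s) :
    μ.real {ω | 0 < Y ω} = r := by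
  obtain ⟨h1, h2, h3⟩ := h
  have hm : ∀ s : Set ℤ, MeasurableSet (Y ⁻¹' s) := fun s => hY MeasurableSet.of_discrete
  have hle : μ.real (Y ⁻¹' {1}) ≤ μ.real (Y ⁻¹' Set.Ioi 0) :=
    measureReal_mono (Set.preimage_mono (by simp))
  have u1 := measureReal_union (μ := μ)
    (Disjoint.preimage Y (s := {-1}) (t := {0}) (by simp)) (hm {0})
  have u2 := measureReal_union (μ := μ)
    (Disjoint.preimage Y (s := Set.Ioi 0) (t := {-1} ∪ {0}) (by simp)) (hm _)
  rw [Set.preimage_union, u1] at u2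
  have hge := measureReal_le_one (μ := μ) (s := Y ⁻¹' Set.Ioi 0 ∪ (Y ⁻¹' {-1} ∪ Y ⁻¹' {0}))
  change μ.real (Y ⁻¹' {1}) = r at h1
  change μ.real (Y ⁻¹' {-1}) = s at h2
  change μ.real (Y ⁻¹' {0}) = 1 - r - s at h3
  change μ.real (Y ⁻¹' Set.Ioi 0) = r
  linarith

lemma HasSignLaw.neg {Ω : Type*} [MeasurableSpace Ω] {μ : Measure Ω} {Y : Ω → ℤ} {r s : ℝ}
    (h : HasSignLaw μ Y r s) : HasSignLaw μ (fun ω => -Y ω) s r := by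
  obtain ⟨h1, h2, h3⟩ := h
  refine ⟨?_, ?_, ?_⟩
  · simpa only [neg_eq_iff_eq_neg] using h2
  · simpa only [neg_inj] using h1
  · rw [sub_right_comm]
    simpa only [neg_eq_zero] using h3

end Law

/-! ### Two-sided tails on the logarithmic scale -/

section Tails

open Filter

/-- For a count whose mean `m` is at least of order `L ^ 3`, the moment of order `K ≈ L ^ (5 / 4)`
makes upward deviations of relative size `L ^ (-1 / 12)` exponentially unlikely, and the Gaussian
bound does the same for downward ones. -/
lemma eventually_tail_bounds {c : ℝ} (hc : 0 < c) :
    ∀ᶠ L : ℝ in atTop, ∃ K : ℕ, ∀ m : ℝ, c * L ^ 3 ≤ m →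
      ((m + 162 * (K : ℝ) ^ 2) / ((1 + L ^ (-(1 / 12) : ℝ)) * m)) ^ K ≤ Real.exp (-(2 * L)) ∧
      Real.exp (-((L ^ (-(1 / 12) : ℝ)) ^ 2 * m / 324)) ≤ Real.exp (-(2 * L)) := by
  -- the exponents are `3 - 1 / 12 - 2 * (5 / 4)` (moment correction against `δ m`),
  -- `5 / 4 - 1 / 12 - 1` (`δ K` against `L`) and `3 - 2 / 12 - 1` (`δ ^ 2 m` against `L`)
  have e1 := (tendsto_rpow_atTop (y := 5 / 12) (by norm_num)).eventually_ge_atTop (1296 / c)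
  have e2 := (tendsto_rpow_atTop (y := 1 / 6) (by norm_num)).eventually_ge_atTop 8
  have e3 := (tendsto_rpow_atTop (y := 11 / 6) (by norm_num)).eventually_ge_atTop (648 / c)
  filter_upwards [e1, e2, e3, eventually_ge_atTop 1] with L h1 h2 h3 hL
  have hL0 : 0 < L := by linarith
  set δ := L ^ (-(1 / 12) : ℝ) with hδ
  have hδ0 : 0 < δ := Real.rpow_pos_of_pos hL0 _
  have hδ1 : δ ≤ 1 := Real.rpow_le_one_of_one_le_of_nonpos hL (by norm_num)
  refine ⟨⌈L ^ (5 / 4 : ℝ)⌉₊, fun m hm => ?_⟩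
  set K := ⌈L ^ (5 / 4 : ℝ)⌉₊ with hK
  have hm0 : 0 < m := lt_of_lt_of_le (by positivity) hm
  have hpow1 : 1 ≤ L ^ (5 / 4 : ℝ) := Real.one_le_rpow hL (by norm_num)
  have hK1 : L ^ (5 / 4 : ℝ) ≤ K := Nat.le_ceil _
  have hK2 : (K : ℝ) ≤ 2 * L ^ (5 / 4 : ℝ) := by
    have := Nat.ceil_lt_add_one (zero_le_one.trans hpow1)
    rw [← hK] at this
    linarith
  have hL3 : L ^ 3 = L ^ (3 : ℝ) := by norm_cast
  constructor
  · have hR : 162 * (K : ℝ) ^ 2 ≤ δ / 2 * m := by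
      have a1 : 162 * (K : ℝ) ^ 2 ≤ 648 * L ^ (5 / 2 : ℝ) := by
        have : L ^ (5 / 2 : ℝ) = (L ^ (5 / 4 : ℝ)) ^ 2 := by
          rw [← Real.rpow_natCast, ← Real.rpow_mul hL0.le]
          norm_num
        rw [this]
        nlinarith
      have a2 : δ * L ^ 3 = L ^ (5 / 2 : ℝ) * L ^ (5 / 12 : ℝ) := by
        rw [hL3, hδ, ← Real.rpow_add hL0, ← Real.rpow_add hL0]
        norm_num
      have a3 : 1296 ≤ L ^ (5 / 12 : ℝ) * c := (div_le_iff₀ hc).1 h1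
      have a4 : 1296 * L ^ (5 / 2 : ℝ) ≤ δ * (c * L ^ 3) := by
        rw [mul_left_comm, a2]
        nlinarith [Real.rpow_pos_of_pos hL0 (5 / 2)]
      nlinarith
    have hq : (m + 162 * (K : ℝ) ^ 2) / ((1 + δ) * m) ≤ Real.exp (-(δ / 4)) := by
      refine le_trans ?_ (Real.one_sub_le_exp_neg _)
      rw [div_le_iff₀ (by positivity)]
      have : 0 ≤ m * (δ * (1 - δ)) := by
        have := sub_nonneg.2 hδ1
        positivity
      nlinarith
    refine (pow_le_pow_left₀ (by positivity) hq K).trans ?_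
    rw [← Real.exp_nat_mul, Real.exp_le_exp]
    have a1 : δ * L ^ (5 / 4 : ℝ) = L * L ^ (1 / 6 : ℝ) := by
      nth_rw 2 [← Real.rpow_one L]
      rw [hδ, ← Real.rpow_add hL0, ← Real.rpow_add hL0]
      norm_num
    nlinarith
  · rw [Real.exp_le_exp]
    have a1 : δ ^ 2 * L ^ 3 = L * L ^ (11 / 6 : ℝ) := by
      nth_rw 2 [← Real.rpow_one L]
      rw [hL3, hδ, ← Real.rpow_natCast, ← Real.rpow_mul hL0.le, ← Real.rpow_add hL0,
        ← Real.rpow_add hL0]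
      norm_num
    have a2 : 648 ≤ L ^ (11 / 6 : ℝ) * c := (div_le_iff₀ hc).1 h3
    have a3 : 648 * L ≤ δ ^ 2 * (c * L ^ 3) := by
      rw [mul_left_comm, a1]
      nlinarith
    have a4 : δ ^ 2 * (c * L ^ 3) ≤ δ ^ 2 * m := mul_le_mul_of_nonneg_left hm (by positivity)
    linarith

open Classical in
lemma SparseFamily.two_sided_tail {V ι : Type*} [Fintype V] [DecidableEq V] {p : V → ℝ}
    {I : Finset ι} {B : ι → Finset V} (hB : SparseFamily p I B) (hp0 : ∀ e, 0 ≤ p e)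
    (hp1 : ∀ e, p e ≤ 1) (hm : 0 < inclMean p I B) (K : ℕ) {δ : ℝ} (hδ : 0 ≤ δ) :
    subsetExp p (fun S =>
        if δ * inclMean p I B < |inclCount I B S - inclMean p I B| then 1 else 0) ≤
      ((inclMean p I B + 162 * (K : ℝ) ^ 2) / ((1 + δ) * inclMean p I B)) ^ K +
        Real.exp (-(δ ^ 2 * inclMean p I B / 324)) := by
  refine le_trans ?_ (add_le_add (hB.upper_tail hp0 hp1 K (a := (1 + δ) * inclMean p I B)
    (by positivity)) (hB.lower_tail hp0 hp1 hδ))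
  rw [subsetExp, subsetExp, subsetExp, ← Finset.sum_add_distrib]
  refine Finset.sum_le_sum fun S _ => ?_
  rw [← mul_add]
  refine mul_le_mul_of_nonneg_left ?_ (subsetWeight_nonneg hp0 hp1 S)
  by_cases h : δ * inclMean p I B < |inclCount I B S - inclMean p I B|
  · rw [if_pos h]
    rcases lt_abs.1 h with h' | h'
    · rw [if_pos (by linarith)]
      split_ifs <;> norm_num
    · rw [if_pos (c := inclCount I B S < _) (by linarith)]
      split_ifs <;> norm_num
  · rw [if_neg h]
    split_ifs <;> norm_num

end Tails

/-! ### Stability of the estimators -/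

section Estimators

lemma cbrt_eq_of_pow_eq {y z : ℝ} (h : z ^ 3 = y) : cbrt y = z :=
  (Odd.strictMono_pow (by decide : Odd 3)).injective ((cbrt_pow_three y).trans h.symm)

lemma cbrt_pow_three_mul (t y : ℝ) : cbrt (t ^ 3 * y) = t * cbrt y :=
  cbrt_eq_of_pow_eq (by rw [mul_pow, cbrt_pow_three])

lemma abs_cbrt_sub_le {b : ℝ} (hb : b ≠ 0) (y : ℝ) :
    |cbrt y - b| ≤ 4 / (3 * b ^ 2) * |y - b ^ 3| := by
  set z := cbrt y with hz
  have hb2 : 0 < b ^ 2 := by positivity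
  have h : |y - b ^ 3| = |z - b| * (z ^ 2 + z * b + b ^ 2) := by
    have h1 : 0 ≤ z ^ 2 + z * b + b ^ 2 := by nlinarith [sq_nonneg (z + b), sq_nonneg z]
    have h2 : y - b ^ 3 = (z - b) * (z ^ 2 + z * b + b ^ 2) := by
      rw [← cbrt_pow_three y]
      ring
    rw [h2, abs_mul, abs_of_nonneg h1]
  rw [h, div_mul_eq_mul_div, le_div_iff₀ (by positivity)]
  nlinarith [mul_nonneg (abs_nonneg (z - b)) (sq_nonneg (2 * z + b))]

/-- The rescaled counts `u = 2 N / (n log n)` and `v = 6 T / (log n) ^ 3` determine both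
estimators. -/
lemma alphaHat_betaHat_eq {n : ℕ} (hL : 0 < Real.log n) (G : SimpleGraph (Fin n)) {u v : ℝ}
    (hu : u = 2 * (numEdges G : ℝ) / (n * Real.log n))
    (hv : v = 6 * (numTriangles G : ℝ) / Real.log n ^ 3) :
    alphaHat G = u + cbrt (v - u ^ 3) ∧ betaHat G = u - cbrt (v - u ^ 3) := by
  have hn : (n : ℝ) ≠ 0 := fun h => by simp [h] at hL
  have h1 : 6 * (numTriangles G : ℝ) - 8 * (numEdges G : ℝ) ^ 3 / (n : ℝ) ^ 3 =
      Real.log n ^ 3 * (v - u ^ 3) := by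
    rw [hu, hv]
    field_simp
    ring
  have h2 : 2 * (numEdges G : ℝ) / n = Real.log n * u := by
    rw [hu]
    field_simp
  constructor
  · rw [alphaHat, h1, h2, cbrt_pow_three_mul]
    field_simp
  · rw [betaHat, h1, h2, cbrt_pow_three_mul]
    field_simp

lemma exists_abs_add_cbrt_sub_le (a : ℝ) {b C : ℝ} (hb : b ≠ 0) (hC : 0 < C) :
    ∃ D : ℝ, 0 < D ∧ ∀ u v η : ℝ, 0 ≤ η → η ≤ 1 → |u - a| ≤ C * η →
      |v - (a ^ 3 + b ^ 3)| ≤ C * η →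
      |u + cbrt (v - u ^ 3) - (a + b)| ≤ D * η ∧ |u - cbrt (v - u ^ 3) - (a - b)| ≤ D * η := by
  set E := C + C * (3 * (|a| + C) ^ 2) with hE
  have hE0 : 0 < E := by positivity
  refine ⟨C + 4 / (3 * b ^ 2) * E, by positivity, fun u v η hη0 hη1 hu hv => ?_⟩
  have hu' : |u| ≤ |a| + C := by
    have h1 : |u| ≤ |u - a| + |a| := by simpa using abs_add_le (u - a) a
    nlinarith
  have hu3 : |u ^ 3 - a ^ 3| ≤ C * η * (3 * (|a| + C) ^ 2) := by
    have h1 : u ^ 3 - a ^ 3 = (u - a) * (u ^ 2 + u * a + a ^ 2) := by ring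
    have h2 : |u ^ 2 + u * a + a ^ 2| ≤ 3 * (|a| + C) ^ 2 := by
      refine (abs_add_three _ _ _).trans ?_
      rw [abs_mul, abs_pow, abs_pow]
      have := abs_nonneg u
      have := abs_nonneg a
      nlinarith
    rw [h1, abs_mul]
    exact mul_le_mul hu h2 (abs_nonneg _) (by positivity)
  have hy : |v - u ^ 3 - b ^ 3| ≤ E * η := by
    have h1 : v - u ^ 3 - b ^ 3 = (v - (a ^ 3 + b ^ 3)) - (u ^ 3 - a ^ 3) := by ring
    rw [h1]
    refine (abs_sub _ _).trans ?_
    rw [hE]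
    linarith
  have hz : |cbrt (v - u ^ 3) - b| ≤ 4 / (3 * b ^ 2) * E * η := by
    refine (abs_cbrt_sub_le hb _).trans ?_
    rw [mul_assoc]
    exact mul_le_mul_of_nonneg_left hy (by positivity)
  rw [add_mul]
  constructor
  · refine le_trans (le_of_eq ?_) ((abs_add_le (u - a) (cbrt (v - u ^ 3) - b)).trans
      (add_le_add hu hz))
    congr 1
    ring
  · refine le_trans (le_of_eq ?_) ((abs_sub (u - a) (cbrt (v - u ^ 3) - b)).trans
      (add_le_add hu hz))
    congr 1
    ring

open Filter Topology in
/-- Near parameters with `0 < β⁺ < α⁺` and `0 < α⁻ < β⁻` the weight `ξ` is well defined and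
Lipschitz at that point. -/
lemma exists_abs_xi_sub_le {αPos βPos αNeg βNeg : ℝ} (hβPos : 0 < βPos) (hPos : βPos < αPos)
    (hαNeg : 0 < αNeg) (hNeg : αNeg < βNeg) :
    ∃ c ε : ℝ, 0 < c ∧ 0 < ε ∧ ∀ a b a' b' η : ℝ, η < ε → |a - αPos| ≤ η → |b - βPos| ≤ η →
      |a' - αNeg| ≤ η → |b' - βNeg| ≤ η →
      (0 < b' / a' ∧ 0 < a / b ∧ Real.log (a / b) ≠ 0) ∧
        |xi a b a' b' - xi αPos βPos αNeg βNeg| ≤ c * η := by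
  have hαPos : 0 < αPos := hβPos.trans hPos
  have hβNeg : 0 < βNeg := hαNeg.trans hNeg
  set f : ℝ × ℝ × ℝ × ℝ → ℝ := fun q => xi q.1 q.2.1 q.2.2.1 q.2.2.2 with hf
  set q₀ : ℝ × ℝ × ℝ × ℝ := (αPos, βPos, αNeg, βNeg) with hq₀
  have hlog : Real.log (αPos / βPos) ≠ 0 :=
    (Real.log_pos ((one_lt_div hβPos).2 hPos)).ne'
  have hP : DifferentiableAt ℝ (fun q : ℝ × ℝ × ℝ × ℝ => q.1 / q.2.1) q₀ := by
    fun_prop (disch := exact hβPos.ne')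
  have hN : DifferentiableAt ℝ (fun q : ℝ × ℝ × ℝ × ℝ => q.2.2.2 / q.2.2.1) q₀ := by
    fun_prop (disch := exact hαNeg.ne')
  have hlogP := hP.log (div_pos hαPos hβPos).ne'
  have hd : DifferentiableAt ℝ f q₀ := by
    change DifferentiableAt ℝ (fun q : ℝ × ℝ × ℝ × ℝ =>
      Real.log (q.2.2.2 / q.2.2.1) / Real.log (q.1 / q.2.1)) q₀
    have hlogN := hN.log (div_pos hβNeg hαNeg).ne'
    fun_prop (disch := exact hlog)
  obtain ⟨c, hc, hO⟩ := Asymptotics.isBigO_iff'.1 hd.isBigO_sub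
  have e1 := hN.continuousAt.eventually (lt_mem_nhds (div_pos hβNeg hαNeg))
  have e2 := hP.continuousAt.eventually (lt_mem_nhds (div_pos hαPos hβPos))
  have e3 := hlogP.continuousAt.eventually_ne hlog
  obtain ⟨ε, hε, hball⟩ := Metric.eventually_nhds_iff.1 (hO.and (e1.and (e2.and e3)))
  refine ⟨c, ε, hc, hε, fun a b a' b' η hη ha hb ha' hb' => ?_⟩
  have hdist : ‖((a, b, a', b') : ℝ × ℝ × ℝ × ℝ) - q₀‖ ≤ η := by
    simp only [hq₀, Prod.mk_sub_mk, Prod.norm_mk, Real.norm_eq_abs]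
    exact max_le ha (max_le hb (max_le ha' hb'))
  have h := hball (y := (a, b, a', b')) (by rw [dist_eq_norm]; exact hdist.trans_lt hη)
  exact ⟨h.2, h.1.trans (mul_le_mul_of_nonneg_left hdist hc.le)⟩

end Estimators

/-! ### Concentration of the counts in the block model -/

section Concentration

open Filter

/-- The random graph `G` is formed by the entries in `Q` of a symmetric random matrix `A` with
independent entries, and its edge probabilities are `r` inside the communities given by the
balanced labelling `x` and `s` between them. -/
structure IsBlockGraph {Ω : Type*} [MeasurableSpace Ω] (μ : Measure Ω) {n : ℕ} (x : Fin n → ℤ)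
    (A : Ω → Matrix (Fin n) (Fin n) ℤ) (Q : Set ℤ) (G : Ω → SimpleGraph (Fin n)) (r s : ℝ) :
    Prop where
  balanced : IsBalancedLabel x
  measurable_entry : ∀ i j, Measurable fun ω => A ω i j
  symm : ∀ ω i j, A ω i j = A ω j i
  indep : iIndepFun (fun (e : {e : Fin n × Fin n // e.1 < e.2}) ω => A ω e.1.1 e.1.2) μ
  adj_iff : ∀ ω i j, (G ω).Adj i j ↔ A ω i j ∈ Q
  prob_same : ∀ i j, i ≠ j → x i = x j → μ.real {ω | A ω i j ∈ Q} = r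
  prob_diff : ∀ i j, x i ≠ x j → μ.real {ω | A ω i j ∈ Q} = s

lemma IsBalancedLabel.sum_eq_zero {n : ℕ} {x : Fin n → ℤ} (hx : IsBalancedLabel x) :
    ∑ i, (x i : ℝ) = 0 := by
  have h1 : ∀ i, (x i : ℝ) = (if x i = 1 then 1 else 0) - (if x i = -1 then 1 else 0) := fun i => by
    rcases hx.1 i with h | h <;> simp [h]
  rw [Finset.sum_congr rfl fun i _ => h1 i, Finset.sum_sub_distrib, Finset.sum_boole,
    Finset.sum_boole, hx.2, sub_self]

/-- The numbers `2 N` and `6 T` of ordered edges and triangles of a block graph concentrate around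
means `m₁` and `m₂` that are, up to the diagonal terms, the sums of the mean matrix over all pairs
and triples. -/
lemma IsBlockGraph.exists_means {Ω : Type*} [MeasurableSpace Ω] {μ : Measure Ω}
    [IsProbabilityMeasure μ] {n : ℕ} {x : Fin n → ℤ} {A : Ω → Matrix (Fin n) (Fin n) ℤ}
    {Q : Set ℤ} {G : Ω → SimpleGraph (Fin n)} {r s : ℝ} (h : IsBlockGraph μ x A Q G r s)
    (hr : 0 ≤ r) (hs : 0 ≤ s) (hn : n * (r + s) ^ 2 ≤ 1) :
    ∃ m₁ m₂ : ℝ, |m₁ - (n : ℝ) ^ 2 * ((r + s) / 2)| ≤ n * (r + s) ∧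
      |m₂ - (n : ℝ) ^ 3 * (((r + s) / 2) ^ 3 + ((r - s) / 2) ^ 3)| ≤
        3 * (n : ℝ) ^ 2 * (r + s) ^ 3 ∧
      ∀ (K : ℕ) (δ : ℝ), 0 ≤ δ →
        (0 < m₁ → μ.real {ω | δ * m₁ < |2 * (numEdges (G ω) : ℝ) - m₁|} ≤
          ((m₁ + 162 * (K : ℝ) ^ 2) / ((1 + δ) * m₁)) ^ K + Real.exp (-(δ ^ 2 * m₁ / 324))) ∧
        (0 < m₂ → μ.real {ω | δ * m₂ < |6 * (numTriangles (G ω) : ℝ) - m₂|} ≤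
          ((m₂ + 162 * (K : ℝ) ^ 2) / ((1 + δ) * m₂)) ^ K + Real.exp (-(δ ^ 2 * m₂ / 324))) := by
  classical
  let p : Sym2 (Fin n) → ℝ := Sym2.lift ⟨fun i j => μ.real {ω | A ω i j ∈ Q}, fun i j => by
    simp only [h.symm _ i j]⟩
  have hp : ∀ i j, p s(i, j) = μ.real {ω | A ω i j ∈ Q} := fun i j => rfl
  have hp0 : ∀ e, 0 ≤ p e := fun e => by
    induction e using Sym2.ind with
    | _ i j => rw [hp]; exact measureReal_nonneg
  have hp1 : ∀ e, p e ≤ 1 := fun e => by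
    induction e using Sym2.ind with
    | _ i j => rw [hp]; exact measureReal_le_one
  have hsq : ∀ i, (x i : ℝ) * x i = 1 := fun i => by rcases h.balanced.1 i with e | e <;> simp [e]
  have hxx : ∀ i j, x i ≠ x j → (x i : ℝ) * x j = -1 := fun i j hij => by
    rcases h.balanced.1 i with e | e <;> rcases h.balanced.1 j with e' | e' <;>
      simp [e, e'] at hij ⊢
  have hbd : ∀ i j, 0 ≤ (r + s) / 2 + (r - s) / 2 * ((x i : ℝ) * x j) ∧
      (r + s) / 2 + (r - s) / 2 * ((x i : ℝ) * x j) ≤ r + s := fun i j => by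
    by_cases hij : x i = x j
    · rw [hij, hsq]
      constructor <;> linarith
    · rw [hxx i j hij]
      constructor <;> linarith
  have hpx : ∀ i j, i ≠ j → p s(i, j) = (r + s) / 2 + (r - s) / 2 * ((x i : ℝ) * x j) := by
    intro i j hne
    rw [hp]
    by_cases hij : x i = x j
    · rw [h.prob_same i j hne hij, hij, hsq]
      ring
    · rw [h.prob_diff i j hij, hxx i j hij]
      ring
  have hB : SparseFamily p (vertexTriples (Fin n)) tripleEdges :=
    sparseFamily_triples hp0 hp1 (fun i j hij => (hpx i j hij).trans_le (hbd i j).2)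
      (by rwa [Fintype.card_fin])
  have hM₁ := abs_inclMean_pairs_sub_le h.balanced.sum_eq_zero hpx (fun i j => (hbd i j).1)
    fun i j => (hbd i j).2
  have hM₂ := abs_inclMean_triples_sub_le h.balanced.sum_eq_zero hsq hpx (fun i j => (hbd i j).1)
    fun i j => (hbd i j).2
  rw [Fintype.card_fin] at hM₁ hM₂
  refine ⟨_, _, hM₁, hM₂, fun K δ hδ => ⟨fun hm => ?_, fun hm => ?_⟩⟩
  · have h1 := measureReal_edgeFinset_le h.measurable_entry h.indep h.adj_iff hp
      (fun S => δ * inclMean p (vertexPairs (Fin n)) pairEdges <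
        |inclCount (vertexPairs (Fin n)) pairEdges S -
          inclMean p (vertexPairs (Fin n)) pairEdges|)
    simp only [inclCount_pairs_edgeFinset] at h1
    exact h1.trans (sparseFamily_pairs.two_sided_tail hp0 hp1 hm K hδ)
  · have h1 := measureReal_edgeFinset_le h.measurable_entry h.indep h.adj_iff hp
      (fun S => δ * inclMean p (vertexTriples (Fin n)) tripleEdges <
        |inclCount (vertexTriples (Fin n)) tripleEdges S -
          inclMean p (vertexTriples (Fin n)) tripleEdges|)
    simp only [inclCount_triples_edgeFinset] at h1
    exact h1.trans (hB.two_sided_tail hp0 hp1 hm K hδ)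

/-- Up to the normalization `t`, a count `y` with relative deviation `δ` from its mean is close to
the limit `σ` of the normalized mean. -/
lemma abs_div_sub_le {t y m σ e δ κ : ℝ} (ht : 0 < t) (hδ0 : 0 ≤ δ) (hδ1 : δ ≤ 1)
    (he : e ≤ δ * t) (hm : |m - t * σ| ≤ e * κ) (hy : |y - m| ≤ δ * m) (hκ : 0 ≤ κ) :
    |y / t - σ| ≤ (σ + 2 * κ) * δ := by
  have h1 : |y - t * σ| ≤ δ * m + e * κ := (abs_sub_le _ m _).trans (add_le_add hy hm)
  have h2 : m ≤ t * σ + e * κ := by linarith [(abs_le.1 hm).2]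
  have h3 : y / t - σ = (y - t * σ) / t := by field_simp
  rw [h3, abs_div, abs_of_pos ht, div_le_iff₀ ht]
  have h4 : δ * m ≤ δ * (t * σ + δ * t * κ) := by
    gcongr
    nlinarith
  have h5 : e * κ ≤ δ * t * κ := by gcongr
  have h6 : δ * (δ * t * κ) ≤ 1 * (δ * t * κ) := by gcongr
  linarith

/-- When the edge probabilities are `α log n / n` and `β log n / n`, the rescaled counts of edges
and triangles are close to `a` and `a ^ 3 + b ^ 3`, where `a = (α + β) / 2` and
`b = (α - β) / 2`. -/
lemma exists_eventually_counts {α β : ℝ} (hα : 0 < α) (hβ : 0 < β) :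
    ∃ C : ℝ, 0 < C ∧ ∀ᶠ n : ℕ in atTop, ∀ (x : Fin n → ℤ) (Ω : Type*) [MeasurableSpace Ω]
      (μ : Measure Ω) [IsProbabilityMeasure μ] (A : Ω → Matrix (Fin n) (Fin n) ℤ) (Q : Set ℤ)
      (G : Ω → SimpleGraph (Fin n)),
      IsBlockGraph μ x A Q G (α * Real.log n / n) (β * Real.log n / n) →
      μ.real {ω | ¬ (|2 * (numEdges (G ω) : ℝ) / (n * Real.log n) - (α + β) / 2| ≤
          C * Real.log n ^ (-(1 / 12) : ℝ) ∧
        |6 * (numTriangles (G ω) : ℝ) / Real.log n ^ 3 -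
            (((α + β) / 2) ^ 3 + ((α - β) / 2) ^ 3)| ≤
          C * Real.log n ^ (-(1 / 12) : ℝ))} ≤ 4 * ((n : ℝ) ^ 2)⁻¹ := by
  obtain ⟨σ, hσ⟩ : ∃ σ, σ = ((α + β) / 2) ^ 3 + ((α - β) / 2) ^ 3 := ⟨_, rfl⟩
  obtain ⟨a, ha⟩ : ∃ a, a = (α + β) / 2 := ⟨_, rfl⟩
  obtain ⟨k, hk⟩ : ∃ k, k = α + β := ⟨_, rfl⟩
  have ha0 : 0 < a := by rw [ha]; positivity
  have hk0 : 0 < k := by rw [hk]; positivity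
  have hσ0 : 0 < σ := by
    have : σ = (α ^ 3 + 3 * (α * β ^ 2)) / 4 := by rw [hσ]; ring
    rw [this]
    positivity
  set c := min (a / 2) (σ / 2) with hc
  have hc0 : 0 < c := lt_min (by positivity) (by positivity)
  have hlog : Tendsto (fun n : ℕ => Real.log n) atTop atTop :=
    Real.tendsto_log_atTop.comp tendsto_natCast_atTop_atTop
  -- `(log n) ^ 2` is negligible compared to `n`
  have hsmall : ∀ κ : ℝ, 0 < κ → ∀ᶠ n : ℕ in atTop, Real.log n ^ 2 ≤ κ * n := by
    intro κ hκ
    have h := (Real.isLittleO_pow_log_id_atTop (n := 2)).comp_tendsto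
      (tendsto_natCast_atTop_atTop (R := ℝ))
    filter_upwards [h.bound hκ] with n hn
    simpa using hn
  refine ⟨(a + 2 * k) + (σ + 2 * (3 * k ^ 3)), by positivity, ?_⟩
  filter_upwards [hlog.eventually (eventually_tail_bounds hc0), hlog.eventually_ge_atTop 1,
    hsmall 1 one_pos, hsmall (1 / k ^ 2) (by positivity), hsmall (a / (2 * k)) (by positivity),
    hsmall (σ / (2 * (3 * k ^ 3))) (by positivity)] with n htail hL1 hn1 hn2 hn3 hn4
  intro x Ω _ μ _ A Q G hG
  rw [← hσ, ← ha]
  have hexp : 0 < (n : ℝ) → Real.exp (-(2 * Real.log n)) = ((n : ℝ) ^ 2)⁻¹ := fun h0 => by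
    rw [Real.exp_neg, two_mul, Real.exp_add, Real.exp_log h0, sq]
  generalize Real.log (n : ℝ) = L at *
  obtain ⟨δ, hδ⟩ : ∃ δ, δ = L ^ (-(1 / 12) : ℝ) := ⟨_, rfl⟩
  rw [← hδ] at htail ⊢
  have hL0 : 0 < L := by linarith
  have hδ0 : 0 < δ := hδ ▸ Real.rpow_pos_of_pos hL0 _
  have hδ1 : δ ≤ 1 := hδ ▸ Real.rpow_le_one_of_one_le_of_nonpos hL1 (by norm_num)
  have hn0 : (0 : ℝ) < n := by nlinarith
  have hLsq : L ≤ L ^ 2 := by nlinarith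
  have h1L : 1 ≤ L ^ 2 := hL1.trans hLsq
  have hnδ : 1 ≤ δ * n := by
    have h1 : L⁻¹ ≤ δ := by
      rw [← Real.rpow_neg_one, hδ]
      exact Real.rpow_le_rpow_of_exponent_le hL1 (by norm_num)
    calc (1 : ℝ) = L⁻¹ * L := (inv_mul_cancel₀ hL0.ne').symm
      _ ≤ δ * n := mul_le_mul h1 (by linarith) hL0.le hδ0.le
  have hrs : α * L / n + β * L / n = k * L / n := by rw [hk]; ring
  have hrs' : α * L / n - β * L / n = (α - β) * L / n := by ring
  obtain ⟨m₁, m₂, hm₁, hm₂, hdev⟩ := hG.exists_means (by positivity) (by positivity) (by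
    rw [hrs]
    have h1 : (n : ℝ) * (k * L / n) ^ 2 = k ^ 2 * L ^ 2 / n := by field_simp
    rw [h1, div_le_one hn0]
    calc k ^ 2 * L ^ 2 ≤ k ^ 2 * (1 / k ^ 2 * (n : ℝ)) := by gcongr
      _ = (n : ℝ) := by field_simp)
  rw [hrs] at hm₁ hm₂
  rw [hrs'] at hm₂
  have e₁ : (n : ℝ) ^ 2 * (k * L / n / 2) = n * L * a := by
    rw [ha, ← hk]
    field_simp
  have e₁' : (n : ℝ) * (k * L / n) = L * k := by field_simp
  have e₂ : (n : ℝ) ^ 3 * ((k * L / n / 2) ^ 3 + ((α - β) * L / n / 2) ^ 3) = L ^ 3 * σ := by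
    rw [hσ, ← hk]
    field_simp
  have e₂' : 3 * (n : ℝ) ^ 2 * (k * L / n) ^ 3 = L ^ 3 / n * (3 * k ^ 3) := by field_simp
  rw [e₁, e₁'] at hm₁
  rw [e₂, e₂'] at hm₂
  have hm₁c : c * L ^ 3 ≤ m₁ := by
    have h1 : k ≤ a / 2 * n := by
      have : L ^ 2 * (2 * k) ≤ a * n := by
        calc L ^ 2 * (2 * k) ≤ a / (2 * k) * n * (2 * k) := by gcongr
          _ = a * n := by field_simp
      nlinarith
    have h2 := (abs_le.1 hm₁).1
    have h3 : L * k ≤ L * (a / 2 * n) := by gcongr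
    calc c * L ^ 3 ≤ a / 2 * L ^ 3 := by gcongr; exact min_le_left _ _
      _ = a / 2 * (L ^ 2 * L) := by ring
      _ ≤ a / 2 * (n * L) := by gcongr; linarith
      _ ≤ m₁ := by linarith
  have hm₂c : c * L ^ 3 ≤ m₂ := by
    have h1 : 3 * k ^ 3 / n ≤ σ / 2 := by
      rw [div_le_iff₀ hn0]
      have h2 : L ^ 2 * (2 * (3 * k ^ 3)) ≤ σ * n := by
        calc L ^ 2 * (2 * (3 * k ^ 3)) ≤ σ / (2 * (3 * k ^ 3)) * n * (2 * (3 * k ^ 3)) := by gcongr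
          _ = σ * n := by field_simp
      have h3 : 1 * (2 * (3 * k ^ 3)) ≤ L ^ 2 * (2 * (3 * k ^ 3)) := by gcongr
      linarith
    have h2 := (abs_le.1 hm₂).1
    have h3 : L ^ 3 * (3 * k ^ 3 / n) ≤ L ^ 3 * (σ / 2) := by gcongr
    have h4 : L ^ 3 / n * (3 * k ^ 3) = L ^ 3 * (3 * k ^ 3 / n) := by ring
    calc c * L ^ 3 ≤ σ / 2 * L ^ 3 := by gcongr; exact min_le_right _ _
      _ ≤ m₂ := by linarith
  obtain ⟨K, hK⟩ := htail
  have hcL : 0 < c * L ^ 3 := by positivity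
  have hT₁ := (hdev K δ hδ0.le).1 (hcL.trans_le hm₁c)
  have hT₂ := (hdev K δ hδ0.le).2 (hcL.trans_le hm₂c)
  have hK₁ := hK m₁ hm₁c
  have hK₂ := hK m₂ hm₂c
  rw [hexp hn0] at hK₁ hK₂
  have hsub : {ω | ¬ (|2 * (numEdges (G ω) : ℝ) / (n * L) - a| ≤
      ((a + 2 * k) + (σ + 2 * (3 * k ^ 3))) * δ ∧
      |6 * (numTriangles (G ω) : ℝ) / L ^ 3 - σ| ≤ ((a + 2 * k) + (σ + 2 * (3 * k ^ 3))) * δ)} ⊆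
      {ω | δ * m₁ < |2 * (numEdges (G ω) : ℝ) - m₁|} ∪
        {ω | δ * m₂ < |6 * (numTriangles (G ω) : ℝ) - m₂|} := by
    intro ω hω
    by_contra hcon
    simp only [Set.mem_union, Set.mem_ofPred_eq, not_or, not_lt] at hcon
    refine hω ⟨?_, ?_⟩
    · refine (abs_div_sub_le (t := n * L) (by positivity) hδ0.le hδ1 ?_ hm₁ hcon.1 hk0.le).trans ?_
      · calc L = 1 * L := (one_mul L).symm
          _ ≤ δ * n * L := by gcongr
          _ = δ * (n * L) := mul_assoc _ _ _
      · have : 0 ≤ (σ + 2 * (3 * k ^ 3)) * δ := by positivity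
        linarith
    · refine (abs_div_sub_le (t := L ^ 3) (by positivity) hδ0.le hδ1 ?_ hm₂ hcon.2
        (by positivity)).trans ?_
      · rw [div_le_iff₀ hn0]
        calc L ^ 3 = 1 * L ^ 3 := (one_mul _).symm
          _ ≤ δ * n * L ^ 3 := by gcongr
          _ = δ * L ^ 3 * n := by ring
      · have : 0 ≤ (a + 2 * k) * δ := by positivity
        linarith
  refine (measureReal_mono hsub).trans ((measureReal_union_le _ _).trans ?_)
  linarith [hK₁.1, hK₁.2, hK₂.1, hK₂.2]

/-- The positive and the negative edges of a signed block model form block graphs. -/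
lemma IsSSBM.isBlockGraph {Ω : Type*} [MeasurableSpace Ω] {μ : Measure Ω} [IsProbabilityMeasure μ]
    {n : ℕ} {A : Ω → Matrix (Fin n) (Fin n) ℤ} {x : Fin n → ℤ} {pPos pNeg qPos qNeg : ℝ}
    (h : IsSSBM μ A x pPos pNeg qPos qNeg) :
    IsBlockGraph μ x A (Set.Ioi 0) (fun ω => posGraph (A ω)) pPos qPos ∧
      IsBlockGraph μ x A (Set.Iio 0) (fun ω => negGraph (A ω)) pNeg qNeg := by
  have hneg : ∀ i j, {ω | A ω i j ∈ Set.Iio 0} = {ω | 0 < -A ω i j} := fun i j => by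
    ext ω
    simp
  refine ⟨⟨h.balanced, h.measurable_entry, h.symm, h.indep, fun ω i j => ?_,
    fun i j hij hx => (h.law_same i j hij hx).measureReal_pos (h.measurable_entry i j),
    fun i j hx => (h.law_diff i j hx).measureReal_pos (h.measurable_entry i j)⟩,
    ⟨h.balanced, h.measurable_entry, h.symm, h.indep, fun ω i j => ?_,
    fun i j hij hx => (hneg i j).symm ▸
      (h.law_same i j hij hx).neg.measureReal_pos (h.measurable_entry i j).neg,
    fun i j hx => (hneg i j).symm ▸
      (h.law_diff i j hx).neg.measureReal_pos (h.measurable_entry i j).neg⟩⟩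
  · rw [posGraph, SimpleGraph.fromRel_adj, h.symm ω j i, or_self, Set.mem_Ioi,
      and_iff_right_iff_imp]
    rintro h0 rfl
    simp [h.diag] at h0
  · rw [negGraph, SimpleGraph.fromRel_adj, h.symm ω j i, or_self, Set.mem_Iio,
      and_iff_right_iff_imp]
    rintro h0 rfl
    simp [h.diag] at h0

end Concentration

end SignedSBM

theorem proposition2 (αPos βPos αNeg βNeg : ℝ) (hβPos : 0 < βPos) (hPos : βPos < αPos)
    (hαNeg : 0 < αNeg) (hNeg : αNeg < βNeg) :
    ∃ κ : ℝ, 0 < κ ∧ ∃ c : ℝ, 0 < c ∧ ∃ n₀ : ℕ, ∀ n : ℕ, n₀ ≤ n →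
      ∀ (x : Fin n → ℤ) (Ω : Type*) [MeasurableSpace Ω] (μ : Measure Ω) [IsProbabilityMeasure μ]
        (A : Ω → Matrix (Fin n) (Fin n) ℤ),
        SignedSBM.IsSSBM μ A x (αPos * Real.log n / n) (αNeg * Real.log n / n)
          (βPos * Real.log n / n) (βNeg * Real.log n / n) →
        1 - (n : ℝ) ^ (-c) ≤
          μ.real {ω | SignedSBM.XiHatDefined (A ω) ∧
            |SignedSBM.xiHat (A ω) - SignedSBM.xi αPos βPos αNeg βNeg| ≤
              κ * Real.log n ^ (-(1 / 12) : ℝ)} := by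
  open SignedSBM Filter in
  obtain ⟨C, hC, hcount⟩ := exists_eventually_counts (hβPos.trans hPos) hβPos
  obtain ⟨C', hC', hcount'⟩ := exists_eventually_counts hαNeg (hαNeg.trans hNeg)
  obtain ⟨D, hD, hest⟩ := exists_abs_add_cbrt_sub_le ((αPos + βPos) / 2)
    (b := (αPos - βPos) / 2) (by linarith [sub_pos.2 hPos] : (αPos - βPos) / 2 ≠ 0) hC
  obtain ⟨D', hD', hest'⟩ := exists_abs_add_cbrt_sub_le ((αNeg + βNeg) / 2)
    (b := (αNeg - βNeg) / 2) (by linarith [sub_neg.2 hNeg] : (αNeg - βNeg) / 2 ≠ 0) hC'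
  obtain ⟨c, ε, hc, hε, hxi⟩ := exists_abs_xi_sub_le hβPos hPos hαNeg hNeg
  have hlog : Tendsto (fun n : ℕ => Real.log n) atTop atTop :=
    Real.tendsto_log_atTop.comp tendsto_natCast_atTop_atTop
  have hδlim : Tendsto (fun n : ℕ => (D + D') * Real.log n ^ (-(1 / 12) : ℝ)) atTop (nhds 0) := by
    simpa using ((tendsto_rpow_neg_atTop (y := 1 / 12) (by norm_num)).comp hlog).const_mul (D + D')
  obtain ⟨n₀, hn₀⟩ := eventually_atTop.1 ((hcount.and hcount').and
    ((hlog.eventually_ge_atTop 1).and ((eventually_ge_atTop 8).and (hδlim.eventually_lt_const hε))))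
  refine ⟨c * (D + D'), by positivity, 1, one_pos, n₀, fun n hn x Ω _ μ _ A hA => ?_⟩
  obtain ⟨⟨h1, h2⟩, hL1, hn8, hδε⟩ := hn₀ n hn
  set L := Real.log n with hL
  set δ := L ^ (-(1 / 12) : ℝ) with hδ
  have hL0 : 0 < L := by linarith
  have hδ0 : 0 ≤ δ := Real.rpow_nonneg hL0.le _
  have hδ1 : δ ≤ 1 := Real.rpow_le_one_of_one_le_of_nonpos hL1 (by norm_num)
  have h1 := h1 x Ω μ A _ _ hA.isBlockGraph.1
  have h2 := h2 x Ω μ A _ _ hA.isBlockGraph.2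
  set bad₁ := {ω | ¬ (|2 * (numEdges (posGraph (A ω)) : ℝ) / (n * L) - (αPos + βPos) / 2| ≤
    C * δ ∧ |6 * (numTriangles (posGraph (A ω)) : ℝ) / L ^ 3 -
      (((αPos + βPos) / 2) ^ 3 + ((αPos - βPos) / 2) ^ 3)| ≤ C * δ)} with hbad₁
  set bad₂ := {ω | ¬ (|2 * (numEdges (negGraph (A ω)) : ℝ) / (n * L) - (αNeg + βNeg) / 2| ≤
    C' * δ ∧ |6 * (numTriangles (negGraph (A ω)) : ℝ) / L ^ 3 -
      (((αNeg + βNeg) / 2) ^ 3 + ((αNeg - βNeg) / 2) ^ 3)| ≤ C' * δ)} with hbad₂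
  set good := {ω | XiHatDefined (A ω) ∧ |xiHat (A ω) - xi αPos βPos αNeg βNeg| ≤
    c * (D + D') * δ} with hgood
  have hcover : (Set.univ : Set Ω) ⊆ good ∪ (bad₁ ∪ bad₂) := by
    intro ω _
    by_cases hb : ω ∈ bad₁ ∪ bad₂
    · exact Or.inr hb
    left
    simp only [hbad₁, hbad₂, Set.mem_union, Set.mem_ofPred_eq, not_or, not_not] at hb
    obtain ⟨⟨hu, hv⟩, hu', hv'⟩ := hb
    obtain ⟨ea, eb⟩ := alphaHat_betaHat_eq hL0 (posGraph (A ω)) rfl rfl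
    obtain ⟨ea', eb'⟩ := alphaHat_betaHat_eq hL0 (negGraph (A ω)) rfl rfl
    obtain ⟨b1, b2⟩ := hest _ _ δ hδ0 hδ1 hu hv
    obtain ⟨b3, b4⟩ := hest' _ _ δ hδ0 hδ1 hu' hv'
    rw [← ea] at b1
    rw [← eb] at b2
    rw [← ea'] at b3
    rw [← eb'] at b4
    have hle : D * δ ≤ (D + D') * δ := by nlinarith
    have hle' : D' * δ ≤ (D + D') * δ := by nlinarith
    have half : ∀ s t : ℝ, (s + t) / 2 + (s - t) / 2 = s ∧ (s + t) / 2 - (s - t) / 2 = t :=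
      fun s t => ⟨by ring, by ring⟩
    rw [(half _ _).1] at b1 b3
    rw [(half _ _).2] at b2 b4
    have := hxi _ _ _ _ _ hδε (b1.trans hle) (b2.trans hle) (b3.trans hle') (b4.trans hle')
    exact ⟨this.1, this.2.trans (le_of_eq (mul_assoc _ _ _).symm)⟩
  have hone := measureReal_mono (μ := μ) hcover
  have hun := measureReal_union_le (μ := μ) good (bad₁ ∪ bad₂)
  have hun' := measureReal_union_le (μ := μ) bad₁ bad₂
  rw [probReal_univ] at hone
  have hn8' : (8 : ℝ) ≤ n := by exact_mod_cast hn8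
  have hfin : 8 * ((n : ℝ) ^ 2)⁻¹ ≤ (n : ℝ) ^ (-1 : ℝ) := by
    rw [Real.rpow_neg_one, ← div_eq_mul_inv, div_le_iff₀ (by positivity), sq, ← mul_assoc,
      inv_mul_cancel₀ (by positivity), one_mul]
    exact hn8'
  linarith
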